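/- Let $\omega:[0,\infty)\to[0,\infty)$ be a weight function, i.e. nondecreasing, continuous, subadditive, with $\omega(0)=0$, $\int_1^\infty \omega(t)t^{-2}\,dt<\infty$ and $\omega(t)/\log(1+t)\to\infty$ as $t\to\infty$. For $l>0$ put $\|\varphi\|_l=\int_{\mathbb R^n}|\hat\varphi(\xi)|e^{l\omega(|\xi|)}\,d\xi\in[0,\infty]$. Let $\mathcal D^{(\omega)}$ (resp. $\mathcal D^{\{\omega\}}$) be the set of complex-valued $\varphi\in C_c^\infty(\mathbb R^n)$ with $\|\varphi\|_l<\infty$ for all $l>0$ (resp. for some $l>0$), and let $\mathcal E^{(\omega)}$ (resp. $\mathcal E^{\{\omega\}}$) be the set of $f\in C^\infty(\mathbb R^n)$ such that $\varphi f$ is a test function of the corresponding type for every test function $\varphi$ of that type. For $K\subset\mathbb R^n$ compact let $\|f\|_{K,l}$ be the infimum of $\|\varphi f\|_l$ over all test functions $\varphi$ of the corresponding type with $\varphi=1$ on $K$. All nets are indexed by $\varepsilon\in(0,1)$ and $o(\cdot)$ refers to $\varepsilon\to0$. Beurling case: a net $(g_\varepsilon)$ in $\mathcal E^{(\omega)}$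 is moderate if for all compact $K$ and all $h>0$ there is $k>0$ with $\|g_\varepsilon\|_{K,h}=o(e^{k\omega(1/\varepsilon)})$, and negligible if $\|g_\varepsilon\|_{K,h}=o(e^{-k\omega(1/\varepsilon)})$ for all $K$ and all $h,k>0$; a net $(r_\varepsilon)$ of complex numbers is moderate if $|r_\varepsilon|=o(e^{k\omega(1/\varepsilon)})$ for some $k>0$, and negligible if $|r_\varepsilon|=o(e^{-k\omega(1/\varepsilon)})$ for all $k>0$. Roumieu case: a net $(g_\varepsilon)$ in $\mathcal E^{\{\omega\}}$ is moderate if for all compact $K$ and all $k>0$ there is $h>0$ with $\|g_\varepsilon\|_{K,h}=o(e^{k\omega(1/\varepsilon)})$, and negligible if for all compact $K$ there are $k>0$ and $h>0$ with $\|g_\varepsilon\|_{K,h}=o(e^{-k\omega(1/\varepsilon)})$; a net $(r_\varepsilon)$ of complex numbers is moderate if $|r_\varepsilon|=o(e^{k\omega(1/\varepsilon)})$ for all $k>0$, and negligible if $|r_\varepsilon|=o(e^{-k\omega(1/\varepsilon)})$ for some $k>0$. Let $\mathcal G^{(\omega)}(\mathbb R^n)$ (resp. $\mathcal G^{\{\omega\}}(\mathbb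 R^n)$) be the algebra of moderate nets of functions modulo negligible nets, and $\tilde{\mathbb C}^{(\omega)}$ (resp. $\tilde{\mathbb C}^{\{\omega\}}$) the ring of generalized constants, i.e. moderate nets of complex numbers modulo negligible ones, mapped to the algebra by regarding numbers as constant functions. Classes are denoted $[(\cdot)]$. **Theorem.** Let $f=[(f_\varepsilon)]$ be an element of $\mathcal G^{(\omega)}(\mathbb R^n)$ (resp. $\mathcal G^{\{\omega\}}(\mathbb R^n)$). If $f(\cdot+x)-f(\cdot)=0$ in this algebra for every $x\in\mathbb R^n$, then $f$ is equal to a Beurling (resp. Roumieu) generalized constant, namely $f=[(f_\varepsilon(0))]$. -/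

import Mathlib

open MeasureTheory Filter Topology
open scoped ENNReal FourierTransform

/-- Euclidean space `ℝⁿ`. -/
abbrev Rn (n : ℕ) : Type := EuclideanSpace ℝ (Fin n)

/-- Weight functions: nondecreasing continuous subadditive functions `ω` on `[0, ∞)` with
`ω(0) = 0`, `∫_1^∞ ω(t)/t² dt < ∞` and `ω(t)/log(1+t) → ∞` as `t → ∞`. They are automatically
nonnegative, and positive on `(0, ∞)`. The values at negative arguments are never used. -/
structure WeightFunction where
  toFun : ℝ → ℝ
  continuousOn : ContinuousOn toFun (Set.Ici 0)
  monotoneOn : MonotoneOn toFun (Set.Ici 0)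
  map_zero : toFun 0 = 0
  subadditive : ∀ s t, 0 ≤ s → 0 ≤ t → toFun (s + t) ≤ toFun s + toFun t
  integrableOn : IntegrableOn (fun t => toFun t / t ^ 2) (Set.Ioi 1)
  tendsto : Tendsto (fun t => toFun t / Real.log (1 + t)) atTop atTop

instance : CoeFun WeightFunction (fun _ => ℝ → ℝ) := ⟨WeightFunction.toFun⟩

namespace Ultra

variable {n : ℕ} (ω : WeightFunction)

theorem weight_nonneg {t : ℝ} (ht : 0 ≤ t) : 0 ≤ ω t := by
  have h := ω.monotoneOn (Set.mem_Ici.2 le_rfl) (Set.mem_Ici.2 ht) ht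
  rwa [ω.map_zero] at h

theorem weight_mono {s t : ℝ} (hs : 0 ≤ s) (hst : s ≤ t) : ω s ≤ ω t :=
  ω.monotoneOn (Set.mem_Ici.2 hs) (Set.mem_Ici.2 (hs.trans hst)) hst

theorem weight_nat_mul (k : ℕ) {t : ℝ} (ht : 0 ≤ t) : ω (k * t) ≤ k * ω t := by
  induction k with
  | zero => simp [ω.map_zero]
  | succ k ih =>
    have := ω.subadditive (k * t) t (by positivity) ht
    push_cast
    rw [add_mul, add_mul, one_mul, one_mul]
    linarith

theorem continuous_weight_norm : Continuous (fun ξ : Rn n => ω ‖ξ‖) :=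
  ω.continuousOn.comp_continuous continuous_norm (fun ξ => Set.mem_Ici.2 (norm_nonneg ξ))

theorem weight_norm_add (ξ η : Rn n) : ω ‖ξ + η‖ ≤ ω ‖ξ‖ + ω ‖η‖ :=
  (weight_mono ω (norm_nonneg _) (norm_add_le ξ η)).trans
    (ω.subadditive _ _ (norm_nonneg _) (norm_nonneg _))

/-- The weighted Fourier norm `∫ |𝓕 f(ξ)| exp(l ω(|ξ|)) dξ`, with values in `[0, ∞]`. -/
noncomputable def fourierNorm (l : ℝ) (f : Rn n → ℂ) : ℝ≥0∞ :=
  ∫⁻ ξ, ‖𝓕 f ξ‖ₑ * ENNReal.ofReal (Real.exp (l * ω ‖ξ‖))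

theorem measurable_expWeight (l : ℝ) :
    Measurable (fun ξ : Rn n => ENNReal.ofReal (Real.exp (l * ω ‖ξ‖))) := by
  have := continuous_weight_norm (n := n) ω
  exact ENNReal.measurable_ofReal.comp (by fun_prop : Continuous _).measurable

theorem continuous_fourier {f : Rn n → ℂ} (hf : Integrable f) : Continuous (𝓕 f) :=
  VectorFourier.fourierIntegral_continuous Real.continuous_fourierChar
    (innerSL ℝ).continuous₂ hf

theorem fourier_add' {f g : Rn n → ℂ} (hf : Integrable f) (hg : Integrable g) :
    𝓕 (f + g) = 𝓕 f + 𝓕 g :=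
  VectorFourier.fourierIntegral_add Real.continuous_fourierChar
    (innerSL ℝ).continuous₂ hf hg

theorem fourier_smul' (c : ℂ) (f : Rn n → ℂ) : 𝓕 (c • f) = c • 𝓕 f :=
  VectorFourier.fourierIntegral_const_smul _ _ _ f c

theorem enorm_circle_smul (z : Circle) (c : ℂ) : ‖z • c‖ₑ = ‖c‖ₑ := by
  rw [← ofReal_norm, ← ofReal_norm, Circle.norm_smul]

theorem fourierNorm_add_le (l : ℝ) {f g : Rn n → ℂ} (hf : Integrable f) (hg : Integrable g) :
    fourierNorm ω l (f + g) ≤ fourierNorm ω l f + fourierNorm ω l g := by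
  unfold fourierNorm
  have hm : Measurable fun ξ : Rn n => ‖𝓕 f ξ‖ₑ * ENNReal.ofReal (Real.exp (l * ω ‖ξ‖)) :=
    (continuous_fourier hf).enorm.measurable.mul (measurable_expWeight ω l)
  rw [fourier_add' hf hg, ← lintegral_add_left hm]
  refine lintegral_mono fun ξ => ?_
  rw [← add_mul]
  gcongr
  exact enorm_add_le _ _

theorem fourierNorm_smul (l : ℝ) (c : ℂ) (f : Rn n → ℂ) :
    fourierNorm ω l (c • f) = ‖c‖ₑ * fourierNorm ω l f := by
  unfold fourierNorm
  rw [fourier_smul', ← lintegral_const_mul' _ _ (by simp)]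
  refine lintegral_congr fun ξ => ?_
  simp [enorm_mul, mul_assoc]

theorem fourierNorm_mono {l m : ℝ} (h : l ≤ m) (f : Rn n → ℂ) :
    fourierNorm ω l f ≤ fourierNorm ω m f := by
  refine lintegral_mono fun ξ => ?_
  have := weight_nonneg ω (norm_nonneg ξ)
  gcongr

theorem fourierNorm_translate (l : ℝ) (f : Rn n → ℂ) (x : Rn n) :
    fourierNorm ω l (fun y => f (y + x)) = fourierNorm ω l f := by
  refine lintegral_congr fun ξ => ?_
  have h : 𝓕 (fun y => f (y + x)) ξ = Real.fourierChar ((innerₗ (Rn n)) x ξ) • 𝓕 f ξ :=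
    congrFun (VectorFourier.fourierIntegral_comp_add_right Real.fourierChar volume
      (innerₗ (Rn n)) f x) ξ
  rw [h, enorm_circle_smul]

theorem enorm_fourier_le (l : ℝ) (hl : 0 ≤ l) (f : Rn n → ℂ) :
    ∫⁻ ξ, ‖𝓕 f ξ‖ₑ ≤ fourierNorm ω l f := by
  refine lintegral_mono fun ξ => ?_
  have h := weight_nonneg ω (norm_nonneg ξ)
  have : (1 : ℝ≥0∞) ≤ ENNReal.ofReal (Real.exp (l * ω ‖ξ‖)) :=
    ENNReal.one_le_ofReal.2 (Real.one_le_exp (by positivity))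
  exact le_mul_of_one_le_right' this

theorem integrable_fourier {l : ℝ} (hl : 0 ≤ l) {f : Rn n → ℂ} (hf : Integrable f)
    (h : fourierNorm ω l f ≠ ∞) : Integrable (𝓕 f) :=
  ⟨(continuous_fourier hf).aestronglyMeasurable,
    ((enorm_fourier_le ω l hl f).trans_lt h.lt_top)⟩

theorem enorm_le_fourierNorm {l : ℝ} (hl : 0 ≤ l) {f : Rn n → ℂ} (hc : Continuous f)
    (hf : Integrable f) (x : Rn n) : ‖f x‖ₑ ≤ fourierNorm ω l f := by
  by_cases h : fourierNorm ω l f = ∞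
  · simp [h]
  have hi := integrable_fourier ω hl hf h
  rw [← congrFun (hc.fourierInv_fourier_eq hf hi) x, Real.fourierInv_eq]
  refine (enorm_integral_le_lintegral_enorm _).trans ?_
  refine le_trans (le_of_eq (lintegral_congr fun ξ => ?_)) (enorm_fourier_le ω l hl f)
  exact enorm_circle_smul _ _

/-- The Fourier transform of a product is the convolution of the Fourier transforms. -/
theorem fourier_mul {f g : Rn n → ℂ} (hc : Continuous f) (hf : Integrable f)
    (hi : Integrable (𝓕 f)) (hg : Integrable g) (ξ : Rn n) :
    𝓕 (f * g) ξ = ∫ η, 𝓕 f η * 𝓕 g (ξ - η) := by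
  have hG : Integrable (fun x => (Real.fourierChar (-inner ℝ x ξ) : ℂ) * g x) := by
    simpa [Circle.smul_def] using (Real.fourierIntegral_convergent_iff ξ).2 hg
  have key := VectorFourier.integral_fourierIntegral_smul_eq_flip (μ := volume) (ν := volume)
    (L := -innerₗ (Rn n)) (f := 𝓕 f) (g := fun x => (Real.fourierChar (-inner ℝ x ξ) : ℂ) * g x)
    Real.continuous_fourierChar
    (by
      have : Continuous fun p : Rn n × Rn n => -inner ℝ p.1 p.2 := by fun_prop
      simpa using this) hi hG
  have h1 : ∀ x, VectorFourier.fourierIntegral Real.fourierChar volume (-innerₗ (Rn n)) (𝓕 f) x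
      = f x := fun x => congrFun (hc.fourierInv_fourier_eq hf hi) x
  rw [Real.fourier_eq]
  simp only [h1] at key
  refine Eq.trans ?_ (key.trans ?_)
  · refine integral_congr_ae (Eventually.of_forall fun x => ?_)
    simp only [Circle.smul_def, Pi.mul_apply, smul_eq_mul]
    ring
  · refine integral_congr_ae (Eventually.of_forall fun η => ?_)
    simp only [smul_eq_mul]
    congr 1
    rw [Real.fourier_eq, VectorFourier.fourierIntegral]
    refine integral_congr_ae (Eventually.of_forall fun x => ?_)
    simp only [Circle.smul_def, smul_eq_mul, ← mul_assoc]
    congr 1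
    rw [← Circle.coe_mul, ← AddChar.map_add_eq_mul]
    congr 2
    simp [inner_sub_right, real_inner_comm]
    ring

theorem fourierNorm_mul_le {l : ℝ} (hl : 0 ≤ l) {f g : Rn n → ℂ} (hc : Continuous f)
    (hf : Integrable f) (hg : Integrable g) (h : fourierNorm ω l f ≠ ∞) :
    fourierNorm ω l (f * g) ≤ fourierNorm ω l f * fourierNorm ω l g := by
  have hi := integrable_fourier ω hl hf h
  have mf := (continuous_fourier hf).enorm.measurable
  have mg := (continuous_fourier hg).enorm.measurable
  have mw := measurable_expWeight (n := n) ω l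
  set w : Rn n → ℝ≥0∞ := fun ξ => ENNReal.ofReal (Real.exp (l * ω ‖ξ‖)) with hw
  have hsub : ∀ ξ η, w ξ ≤ w η * w (ξ - η) := by
    intro ξ η
    simp only [hw]
    rw [← ENNReal.ofReal_mul (Real.exp_nonneg _), ← Real.exp_add, ← mul_add]
    have := weight_norm_add ω η (ξ - η)
    rw [add_sub_cancel] at this
    gcongr
  calc fourierNorm ω l (f * g)
      ≤ ∫⁻ ξ, ∫⁻ η, (‖𝓕 f η‖ₑ * w η) * (‖𝓕 g (ξ - η)‖ₑ * w (ξ - η)) := by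
        refine lintegral_mono fun ξ => ?_
        rw [fourier_mul hc hf hi hg]
        calc ‖∫ η, 𝓕 f η * 𝓕 g (ξ - η)‖ₑ * w ξ
            ≤ (∫⁻ η, ‖𝓕 f η * 𝓕 g (ξ - η)‖ₑ) * w ξ := by
              gcongr
              exact enorm_integral_le_lintegral_enorm _
          _ = ∫⁻ η, ‖𝓕 f η * 𝓕 g (ξ - η)‖ₑ * w ξ := by
              rw [lintegral_mul_const' _ _ (by simp [hw])]
          _ ≤ _ := by
              refine lintegral_mono fun η => ?_
              rw [enorm_mul]
              calc _ ≤ ‖𝓕 f η‖ₑ * ‖𝓕 g (ξ - η)‖ₑ * (w η * w (ξ - η)) := by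
                    gcongr
                    exact hsub ξ η
                _ = _ := by ring
    _ = ∫⁻ η, ∫⁻ ξ, (‖𝓕 f η‖ₑ * w η) * (‖𝓕 g (ξ - η)‖ₑ * w (ξ - η)) := by
        refine lintegral_lintegral_swap (Measurable.aemeasurable ?_)
        exact ((mf.mul mw).comp measurable_snd).mul
          ((mg.mul mw).comp (measurable_fst.sub measurable_snd))
    _ = ∫⁻ η, (‖𝓕 f η‖ₑ * w η) * fourierNorm ω l g := by
        refine lintegral_congr fun η => ?_
        have hm : Measurable fun ξ => ‖𝓕 g (ξ - η)‖ₑ * w (ξ - η) :=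
          (mg.mul mw).comp (measurable_id.sub_const η)
        rw [lintegral_const_mul _ hm]
        congr 1
        exact lintegral_sub_right_eq_self (fun ξ => ‖𝓕 g ξ‖ₑ * w ξ) η
    _ = _ := by
        have hm : Measurable fun η => ‖𝓕 f η‖ₑ * w η := mf.mul mw
        rw [lintegral_mul_const _ hm]
        rfl


theorem norm_charFun_unif_le {b : ℝ} (hb : b ≠ 0) :
    ‖∫ x : unitInterval, Complex.exp ((b * (x : ℝ) : ℝ) * Complex.I)‖ ≤ min 1 (2 / |b|) := by
  refine le_min ?_ ?_
  · refine (norm_integral_le_integral_norm _).trans ?_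
    simp only [Complex.norm_exp_ofReal_mul_I]
    simp
  · have h0 : ∫ x : unitInterval, Complex.exp ((b * (x : ℝ) : ℝ) * Complex.I)
        = ∫ x in (0:ℝ)..1, Complex.exp ((b * Complex.I) * x) := by
      rw [intervalIntegral.integral_of_le zero_le_one, ← integral_Icc_eq_integral_Ioc]
      refine Eq.trans ?_ (integral_subtype measurableSet_Icc
        (fun x : ℝ => Complex.exp ((b * Complex.I) * x)))
      refine integral_congr_ae (Eventually.of_forall fun x => ?_)
      simp only [Complex.ofReal_mul]
      congr 1
      ring
    have hb' : (b : ℂ) * Complex.I ≠ 0 := by simp [hb]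
    rw [h0, integral_exp_mul_complex hb', norm_div]
    have e1 : ‖(b : ℂ) * Complex.I‖ = |b| := by simp
    rw [e1]
    gcongr
    refine (norm_sub_le _ _).trans ?_
    have e2 : (b : ℂ) * Complex.I * (1 : ℝ) = (b : ℝ) * Complex.I := by simp
    rw [e2, Complex.norm_exp_ofReal_mul_I]
    norm_num

theorem exists_measure_of_summable {ι : Type} [Countable ι] (a : ι → ℝ) (ha : ∀ i, 0 < a i)
    (hs : Summable a) :
    ∃ ν : Measure ℝ, IsProbabilityMeasure ν ∧ (∀ᵐ x ∂ν, |x| ≤ ∑' i, a i) ∧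
      ∀ t : ℝ, t ≠ 0 → ∀ s : Finset ι, ‖charFun ν t‖ ≤ ∏ i ∈ s, min 1 (2 / |t * a i|) := by
  classical
  set P : Measure (ι → unitInterval) := Measure.infinitePi (fun _ => volume) with hP
  have hb : ∀ i (w : ι → unitInterval), ‖a i * (w i : ℝ)‖ ≤ a i := by
    intro i w
    rw [norm_mul, Real.norm_of_nonneg (ha i).le, Real.norm_of_nonneg (w i).2.1]
    exact mul_le_of_le_one_right (ha i).le (w i).2.2
  set X : (ι → unitInterval) → ℝ := fun w => ∑' i, a i * (w i : ℝ) with hX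
  have hXc : Continuous X := continuous_tsum (fun i => by fun_prop) hs hb
  have hXm : Measurable X := hXc.measurable
  have hsum : ∀ w : ι → unitInterval, Summable fun i => a i * (w i : ℝ) := fun w =>
    Summable.of_norm_bounded hs (fun i => hb i w)
  refine ⟨P.map X, Measure.isProbabilityMeasure_map hXm.aemeasurable, ?_, ?_⟩
  · rw [ae_map_iff hXm.aemeasurable (by measurability)]
    exact Eventually.of_forall fun w => tsum_of_norm_bounded hs.hasSum (fun i => hb i w)
  intro t ht s
  have hind : ProbabilityTheory.iIndepFun (fun i (w : ι → unitInterval) => a i * (w i : ℝ)) P :=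
    ProbabilityTheory.iIndepFun_infinitePi (X := fun i (x : unitInterval) => a i * (x : ℝ))
      (fun i => by fun_prop)
  have hlim : Tendsto (fun S : Finset ι => charFun (P.map (∑ i ∈ S, fun w => a i * (w i : ℝ))) t)
      atTop (𝓝 (charFun (P.map X) t)) := by
    have hre : ∀ Y : (ι → unitInterval) → ℝ, Measurable Y → charFun (P.map Y) t =
        ∫ w, Complex.exp ((t * Y w : ℝ) * Complex.I) ∂P := by
      intro Y hY
      rw [charFun_apply_real, integral_map hY.aemeasurable
        (Continuous.aestronglyMeasurable (by fun_prop))]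
      simp
    have hYm : ∀ S : Finset ι, Measurable (∑ i ∈ S, fun w : ι → unitInterval => a i * (w i : ℝ)) :=
      fun S => by fun_prop
    rw [hre X hXm]
    simp_rw [fun S => hre _ (hYm S)]
    refine tendsto_integral_filter_of_dominated_convergence (fun _ => (1 : ℝ)) ?_ ?_ ?_ ?_
    · refine Eventually.of_forall fun S => ?_
      have := hYm S
      exact (Measurable.aestronglyMeasurable (by fun_prop))
    · refine Eventually.of_forall fun S => Eventually.of_forall fun w => ?_
      rw [Complex.norm_exp_ofReal_mul_I]
    · exact integrable_const _
    · refine Eventually.of_forall fun w => ?_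
      have h1 : Tendsto (fun S : Finset ι => (∑ i ∈ S, fun w : ι → unitInterval => a i * (w i : ℝ)) w)
          atTop (𝓝 (X w)) := by
        simpa [Finset.sum_apply, HasSum, hX] using (hsum w).hasSum
      have hc : Continuous fun y : ℝ => Complex.exp ((t * y : ℝ) * Complex.I) := by fun_prop
      exact (hc.tendsto _).comp h1
  refine le_of_tendsto hlim.norm ?_
  filter_upwards [eventually_ge_atTop s] with S hS
  rw [ProbabilityTheory.iIndepFun.charFun_map_finsetSum_eq_prod (fun i _ => Measurable.aemeasurable
    (by fun_prop)) (hind.restrict S), Finset.prod_apply, norm_prod]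
  have hfac : ∀ i, ‖charFun (P.map fun w : ι → unitInterval => a i * (w i : ℝ)) t‖
      ≤ min 1 (2 / |t * a i|) := by
    intro i
    have : P.map (fun w : ι → unitInterval => a i * (w i : ℝ)) =
        (volume : Measure unitInterval).map (fun x : unitInterval => a i * (x : ℝ)) := by
      rw [← Measure.infinitePi_map_eval (fun _ : ι => (volume : Measure unitInterval)) i,
        Measure.map_map (by fun_prop) (by fun_prop)]
      rfl
    rw [this, charFun_apply_real, integral_map (by fun_prop)
      (Continuous.aestronglyMeasurable (by fun_prop))]
    refine le_trans (le_of_eq ?_) (norm_charFun_unif_le (mul_ne_zero ht (ha i).ne'))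
    congr 1
    refine integral_congr_ae (Eventually.of_forall fun x => ?_)
    simp [mul_assoc]
  refine (Finset.prod_le_prod (fun i _ => norm_nonneg _) (fun i _ => hfac i)).trans ?_
  rw [← Finset.prod_sdiff hS]
  refine mul_le_of_le_one_left (Finset.prod_nonneg fun i _ => by positivity) ?_
  exact Finset.prod_le_one (fun i _ => by positivity) (fun i _ => min_le_left _ _)

theorem exists_tendsto_summable_mul (c : ℕ → ℝ) (hc : ∀ k, 0 < c k) (hs : Summable c) :
    ∃ m : ℕ → ℝ, (∀ k, 0 ≤ m k) ∧ Tendsto m atTop atTop ∧ Summable fun k => m k * c k := by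
  set T : ℕ → ℝ := fun k => ∑' j, c (j + k) with hT
  have hTs : ∀ k, T k = c k + T (k + 1) := by
    intro k
    have := ((summable_nat_add_iff k).2 hs).tsum_eq_zero_add
    simp only [hT]
    rw [this]
    congr 1
    · simp
    · exact tsum_congr fun j => by congr 1; ring
  have hTn : ∀ k, 0 ≤ T k := fun k => tsum_nonneg fun j => (hc _).le
  have hTp : ∀ k, 0 < T k := fun k => by rw [hTs]; linarith [hc k, hTn (k + 1)]
  have hT0 : Tendsto T atTop (𝓝 0) := tendsto_sum_nat_add c
  have hTq : Tendsto (fun k => Real.sqrt (T k)) atTop (𝓝[>] 0) := by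
    refine tendsto_nhdsWithin_iff.2 ⟨?_, Eventually.of_forall fun k => Real.sqrt_pos.2 (hTp k)⟩
    simpa [Function.comp_def] using (Real.continuous_sqrt.tendsto 0).comp hT0
  refine ⟨fun k => (Real.sqrt (T k))⁻¹, fun k => by positivity,
    hTq.inv_tendsto_nhdsGT_zero, ?_⟩
  have hle : ∀ k, (Real.sqrt (T k))⁻¹ * c k ≤ 2 * (Real.sqrt (T k) - Real.sqrt (T (k + 1))) := by
    intro k
    have h1 := Real.mul_self_sqrt (hTn k)
    have h2 := Real.mul_self_sqrt (hTn (k + 1))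
    have h3 : Real.sqrt (T (k + 1)) ≤ Real.sqrt (T k) :=
      Real.sqrt_le_sqrt (by rw [hTs k]; linarith [hc k])
    have h4 := Real.sqrt_pos.2 (hTp k)
    have h5 : c k = Real.sqrt (T k) * Real.sqrt (T k)
      - Real.sqrt (T (k + 1)) * Real.sqrt (T (k + 1)) := by
      rw [h1, h2, hTs k]; ring
    rw [inv_mul_le_iff₀ h4, h5]
    nlinarith
  refine summable_of_sum_range_le (c := 2 * Real.sqrt (T 0))
    (fun k => mul_nonneg (by positivity) (hc k).le) fun N => ?_
  refine (Finset.sum_le_sum fun k _ => hle k).trans ?_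
  rw [← Finset.mul_sum, Finset.sum_range_sub']
  linarith [Real.sqrt_nonneg (T N)]


theorem summable_weight : Summable fun k : ℕ => ω (2 ^ (k + 1)) / 2 ^ k := by
  have hint : ∀ a b : ℝ, 1 ≤ a → a ≤ b →
      IntervalIntegrable (fun t => ω t / t ^ 2) volume a b := fun a b ha hab =>
    (intervalIntegrable_iff_integrableOn_Ioc_of_le hab).2
      (ω.integrableOn.mono_set fun x hx => lt_of_le_of_lt ha hx.1)
  have hp : ∀ k : ℕ, (1 : ℝ) ≤ 2 ^ k := fun k => one_le_pow₀ (by norm_num)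
  have hle : ∀ k : ℕ, (2 : ℝ) ^ (k + 1) ≤ 2 ^ (k + 1 + 1) := fun k =>
    pow_le_pow_right₀ (by norm_num) (by lia)
  have h1 : ∀ k : ℕ, ω (2 ^ (k + 1)) / 2 ^ k
      ≤ 4 * ∫ t in ((2:ℝ) ^ (k + 1))..(2 ^ (k + 1 + 1)), ω t / t ^ 2 := by
    intro k
    have hp0 : (0:ℝ) < 2 ^ (k + 1) := by positivity
    have hnot : (0:ℝ) ∉ Set.uIcc ((2:ℝ) ^ (k + 1)) (2 ^ (k + 1 + 1)) := by
      rw [Set.uIcc_of_le (hle k)]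
      exact fun h => absurd h.1 (not_le.2 hp0)
    have hi2 : IntervalIntegrable (fun t : ℝ => ω (2 ^ (k + 1)) * t ^ (-2 : ℤ)) volume
        (2 ^ (k + 1)) (2 ^ (k + 1 + 1)) :=
      (intervalIntegral.intervalIntegrable_zpow (Or.inr hnot)).const_mul _
    have hm := intervalIntegral.integral_mono_on (hle k) hi2
      (hint _ _ (hp _) (hle k)) (fun t ht => by
        have ht0 : 0 < t := lt_of_lt_of_le hp0 ht.1
        have := weight_mono ω hp0.le ht.1
        rw [zpow_neg, div_eq_mul_inv]
        have e : t ^ (2:ℤ) = t ^ 2 := by norm_cast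
        rw [e]
        gcongr)
    have hcomp : ∫ t in ((2:ℝ) ^ (k + 1))..(2 ^ (k + 1 + 1)), ω (2 ^ (k + 1)) * t ^ (-2 : ℤ)
        = ω (2 ^ (k + 1)) / 2 ^ k / 4 := by
      rw [intervalIntegral.integral_const_mul, integral_zpow (Or.inr ⟨by norm_num, hnot⟩)]
      norm_num
      field_simp
      ring
    rw [hcomp] at hm
    linarith
  refine summable_of_sum_range_le (c := 4 * ∫ t in Set.Ioi 1, ω t / t ^ 2)
    (fun k => div_nonneg (weight_nonneg ω (by positivity)) (by positivity)) fun N => ?_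
  refine (Finset.sum_le_sum fun k _ => h1 k).trans ?_
  rw [← Finset.mul_sum, intervalIntegral.sum_integral_adjacent_intervals
    (a := fun k : ℕ => (2:ℝ) ^ (k + 1)) (fun k _ => hint _ _ (hp _) (hle k))]
  gcongr
  have h2 : (2:ℝ) ^ (0 + 1) ≤ 2 ^ (N + 1) := pow_le_pow_right₀ (by norm_num) (by lia)
  rw [intervalIntegral.integral_of_le h2]
  refine setIntegral_mono_set ω.integrableOn ?_ (Eventually.of_forall fun x hx => ?_)
  · refine (ae_restrict_iff' measurableSet_Ioi).2 (Eventually.of_forall fun t ht => ?_)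
    exact div_nonneg (weight_nonneg ω (zero_le_one.trans (le_of_lt ht))) (by positivity)
  · exact lt_of_le_of_lt (hp _) hx.1

theorem exists_measure_weight : ∃ ν : Measure ℝ, IsProbabilityMeasure ν ∧
    (∃ R : ℝ, ∀ᵐ x ∂ν, |x| ≤ R) ∧
      ∀ l : ℝ, 0 ≤ l → ∃ C : ℝ, 0 ≤ C ∧ ∀ t, ‖charFun ν t‖ ≤ C * Real.exp (-(l * ω |t|)) := by
  have hgeo : Summable fun k : ℕ => (1 : ℝ) / 2 ^ k := by
    simpa using summable_geometric_two
  obtain ⟨m, hm0, hmt, hms⟩ := exists_tendsto_summable_mul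
    (fun k : ℕ => ω (2 ^ (k + 1)) / 2 ^ k + 1 / 2 ^ k)
    (fun k => by
      have := weight_nonneg ω (t := 2 ^ (k + 1)) (by positivity)
      positivity) ((summable_weight ω).add hgeo)
  set N : ℕ → ℕ := fun k => ⌈m k * ω (2 ^ (k + 1))⌉₊ with hN
  have hw0 : ∀ k : ℕ, 0 ≤ ω (2 ^ (k + 1)) := fun k => weight_nonneg ω (by positivity)
  have hNle : ∀ k, (N k : ℝ) ≤ m k * ω (2 ^ (k + 1)) + 1 := fun k =>
    (Nat.ceil_lt_add_one (mul_nonneg (hm0 k) (hw0 k))).le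
  have hNs : Summable fun k => (N k : ℝ) * (6 / 2 ^ k) := by
    refine Summable.of_nonneg_of_le (fun k => by positivity) (fun k => ?_)
      ((hms.add hgeo).mul_left 6)
    have h1 : (0:ℝ) ≤ m k * (1 / 2 ^ k) := mul_nonneg (hm0 k) (by positivity)
    calc (N k : ℝ) * (6 / 2 ^ k) ≤ (m k * ω (2 ^ (k + 1)) + 1) * (6 / 2 ^ k) := by
          gcongr
          exact hNle k
      _ = 6 * (m k * (ω (2 ^ (k + 1)) / 2 ^ k) + 1 / 2 ^ k) := by ring
      _ ≤ _ := by
          have : m k * (ω (2 ^ (k + 1)) / 2 ^ k + 1 / 2 ^ k)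
            = m k * (ω (2 ^ (k + 1)) / 2 ^ k) + m k * (1 / 2 ^ k) := by ring
          linarith
  have has : Summable fun i : (Σ k : ℕ, Fin (N k)) => (6 : ℝ) / 2 ^ i.1 := by
    refine (summable_sigma_of_nonneg (fun i => by positivity)).2
      ⟨fun k => Summable.of_finite, ?_⟩
    simpa using hNs
  obtain ⟨ν, hν, hsupp, hchar⟩ := exists_measure_of_summable
    (fun i : (Σ k : ℕ, Fin (N k)) => (6 : ℝ) / 2 ^ i.1) (fun i => by positivity) has
  refine ⟨ν, hν, ⟨_, hsupp⟩, fun l hl => ?_⟩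
  have hone : ∀ t, ‖charFun ν t‖ ≤ 1 := fun t => norm_charFun_le_one t
  obtain ⟨k0, hk0⟩ := eventually_atTop.1 (hmt.eventually_ge_atTop l)
  refine ⟨Real.exp (l * ω (2 ^ k0)), (Real.exp_pos _).le, fun t => ?_⟩
  rw [← Real.exp_add]
  rcases lt_or_ge |t| (2 ^ k0) with ht | ht
  · refine (hone t).trans (Real.one_le_exp ?_)
    have := weight_mono ω (abs_nonneg t) ht.le
    nlinarith
  have ht1 : 1 ≤ |t| := (one_le_pow₀ (by norm_num)).trans ht
  have ht0 : t ≠ 0 := by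
    rintro rfl
    norm_num at ht1
  obtain ⟨k, hk1, hk2⟩ := exists_nat_pow_near ht1 (by norm_num : (1:ℝ) < 2)
  have hkk : k0 ≤ k := by
    have : (2:ℝ) ^ k0 < 2 ^ (k + 1) := ht.trans_lt hk2
    have := (pow_lt_pow_iff_right₀ (by norm_num : (1:ℝ) < 2)).1 this
    lia
  have h1 := hchar t ht0 ((Finset.univ : Finset (Fin (N k))).map
    (Function.Embedding.sigmaMk (β := fun k => Fin (N k)) k))
  have h2 : min 1 (2 / |t * (6 / 2 ^ k)|) ≤ Real.exp (-1) := by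
    refine (min_le_right _ _).trans ?_
    rw [abs_mul, abs_of_pos (by positivity : (0:ℝ) < 6 / 2 ^ k), Real.exp_neg,
      div_le_iff₀ (by positivity)]
    have he := Real.exp_one_lt_three
    have h3 : 6 ≤ |t| * (6 / 2 ^ k) := by
      rw [mul_div_assoc', le_div_iff₀ (by positivity)]
      linarith
    rw [inv_mul_eq_div, le_div_iff₀ (Real.exp_pos 1)]
    linarith
  calc ‖charFun ν t‖ ≤ Real.exp (-1) ^ N k :=
        (h1.trans_eq (by simp only [Finset.prod_map, Function.Embedding.sigmaMk_apply,
          Finset.prod_const, Finset.card_univ, Fintype.card_fin])).trans (pow_le_pow_left₀ (by positivity) h2 _)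
    _ = Real.exp (-(N k : ℝ)) := by rw [← Real.exp_nat_mul]; congr 1; ring
    _ ≤ _ := by
      gcongr
      have h4 : m k * ω (2 ^ (k + 1)) ≤ N k := Nat.le_ceil _
      have h5 : ω |t| ≤ ω (2 ^ (k + 1)) := weight_mono ω (abs_nonneg t) hk2.le
      have h6 : l * ω |t| ≤ m k * ω (2 ^ (k + 1)) :=
        mul_le_mul (hk0 k hkk) h5 (weight_nonneg ω (abs_nonneg t)) (hm0 k)
      have h7 := mul_nonneg hl (weight_nonneg ω (t := 2 ^ k0) (by positivity))
      linarith

theorem norm_le_sum_abs (ξ : Rn n) : ‖ξ‖ ≤ ∑ i, |ξ i| := by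
  have h := (EuclideanSpace.basisFun (Fin n) ℝ).sum_repr ξ
  calc ‖ξ‖ = ‖∑ i, (EuclideanSpace.basisFun (Fin n) ℝ).repr ξ i •
        (EuclideanSpace.basisFun (Fin n) ℝ) i‖ := by rw [h]
    _ ≤ _ := by
      refine (norm_sum_le _ _).trans (Finset.sum_le_sum fun i _ => ?_)
      simp [norm_smul]

theorem weight_sum_le {ι : Type} (s : Finset ι) (a : ι → ℝ) (ha : ∀ i, 0 ≤ a i) :
    ω (∑ i ∈ s, a i) ≤ ∑ i ∈ s, ω (a i) := by
  classical
  induction s using Finset.induction_on with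
  | empty => simp [ω.map_zero]
  | insert i s hi ih =>
    rw [Finset.sum_insert hi, Finset.sum_insert hi]
    have := ω.subadditive (a i) (∑ i ∈ s, a i) (ha i) (Finset.sum_nonneg fun i _ => ha i)
    linarith

theorem exists_measure_Rn (n : ℕ) : ∃ μ : Measure (Rn n), IsProbabilityMeasure μ ∧
    (∃ R : ℝ, ∀ᵐ x ∂μ, ‖x‖ ≤ R) ∧
      ∀ l : ℝ, 0 ≤ l → ∃ C : ℝ, 0 ≤ C ∧ ∀ ξ, ‖charFun μ ξ‖ ≤ C * Real.exp (-(l * ω ‖ξ‖)) := by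
  obtain ⟨ν, hν, ⟨R, hR⟩, hchar⟩ := exists_measure_weight ω
  have hm : Measurable (WithLp.toLp 2 : (Fin n → ℝ) → Rn n) := by fun_prop
  refine ⟨(Measure.pi fun _ : Fin n => ν).map (WithLp.toLp 2),
    Measure.isProbabilityMeasure_map hm.aemeasurable, ⟨n * R, ?_⟩, fun l hl => ?_⟩
  · rw [ae_map_iff hm.aemeasurable (measurableSet_le measurable_norm measurable_const)]
    have : ∀ᵐ x ∂(Measure.pi fun _ : Fin n => ν), ∀ i, |x i| ≤ R :=
      ae_all_iff.2 fun i =>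
        (Measure.tendsto_eval_ae_ae (μ := fun _ : Fin n => ν) (i := i)).eventually hR
    filter_upwards [this] with x hx
    refine (norm_le_sum_abs _).trans ((Finset.sum_le_sum fun i _ => hx i).trans ?_)
    simp
  · obtain ⟨C, hC0, hC⟩ := hchar l hl
    refine ⟨C ^ n, by positivity, fun ξ => ?_⟩
    rw [charFun_pi, norm_prod]
    refine (Finset.prod_le_prod (fun i _ => norm_nonneg _) (fun i _ => hC (ξ i))).trans ?_
    rw [Finset.prod_mul_distrib, ← Real.exp_sum]
    simp only [Finset.prod_const, Finset.card_univ, Fintype.card_fin, Finset.sum_neg_distrib,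
      ← Finset.mul_sum]
    have h1 : ω ‖ξ‖ ≤ ∑ i, ω |ξ i| := (weight_mono ω (norm_nonneg _) (norm_le_sum_abs ξ)).trans
      (weight_sum_le ω _ _ fun i => abs_nonneg _)
    gcongr

/-- Existence of cutoff functions, of both types. -/
theorem exists_cutoff {K : Set (Rn n)} (hK : IsCompact K) :
    ∃ χ : Rn n → ℂ, ContDiff ℝ (⊤ : ℕ∞) χ ∧ HasCompactSupport χ ∧ (∀ x ∈ K, χ x = 1) ∧
      ∀ l : ℝ, 0 ≤ l → fourierNorm ω l χ < ∞ := by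
  obtain ⟨μ, hμ, ⟨R, hR⟩, hchar⟩ := exists_measure_Rn ω n
  obtain ⟨r, hr0, hr⟩ := hK.isBounded.exists_pos_norm_le
  let b : ContDiffBump (0 : Rn n) := ⟨r + |R|, r + |R| + 1, by positivity, by linarith⟩
  set ρ : Rn n → ℂ := fun x => ((b x : ℝ) : ℂ) with hρ
  have hρd : ContDiff ℝ (⊤ : ℕ∞) ρ := Complex.ofRealCLM.contDiff.comp b.contDiff
  have hρc : HasCompactSupport ρ := b.hasCompactSupport.comp_left (g := fun x : ℝ => (x : ℂ)) (by simp)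
  have hρi : Integrable ρ := hρd.continuous.integrable_of_hasCompactSupport hρc
  have hFi : Integrable (𝓕 ρ) := by
    have := (SchwartzMap.integrable (μ := volume) (𝓕 (hρc.toSchwartzMap hρd)))
    rwa [SchwartzMap.fourier_coe] at this
  set χ : Rn n → ℂ := convolution (fun _ => (1 : ℂ)) ρ (ContinuousLinearMap.mul ℝ ℂ) μ with hχ
  have hχx : ∀ x, χ x = ∫ y, ρ (x - y) ∂μ := fun x => by simp [hχ, convolution]
  have hχd : ContDiff ℝ (⊤ : ℕ∞) χ := hρc.contDiff_convolution_right _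
    (integrable_const _).locallyIntegrable hρd
  have hFχ : ∀ ξ, ‖𝓕 χ ξ‖ₑ = ‖charFun μ (-(2 * Real.pi) • ξ)‖ₑ * ‖𝓕 ρ ξ‖ₑ := by
    intro ξ
    have hint : Integrable (fun p : Rn n × Rn n => ρ (p.1 - p.2)) (volume.prod μ) := by
      refine (integrable_prod_iff' (Continuous.aestronglyMeasurable
        (hρd.continuous.comp (by fun_prop)))).2 ⟨?_, ?_⟩
      · exact Eventually.of_forall fun y => hρi.comp_sub_right y
      · have : ∀ y, ∫ x, ‖ρ (x - y)‖ = ∫ x, ‖ρ x‖ := fun y =>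
          integral_sub_right_eq_self (fun x => ‖ρ x‖) y
        exact (integrable_const (∫ x, ‖ρ x‖)).congr (Eventually.of_forall fun y => (this y).symm)
    have hint2 : Integrable (fun p : Rn n × Rn n =>
        (Real.fourierChar (-inner ℝ p.1 ξ) : ℂ) * ρ (p.1 - p.2)) (volume.prod μ) := by
      refine hint.bdd_mul (c := 1) (Continuous.aestronglyMeasurable ?_) ?_
      · have := Real.continuous_fourierChar
        fun_prop
      · exact Eventually.of_forall fun p => (Circle.norm_coe _).le
    have e1 : 𝓕 χ ξ = ∫ x, ∫ y, (Real.fourierChar (-inner ℝ x ξ) : ℂ) * ρ (x - y) ∂μ := by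
      rw [Real.fourier_eq]
      refine integral_congr_ae (Eventually.of_forall fun x => ?_)
      simp only [Circle.smul_def, smul_eq_mul]
      rw [hχx, integral_const_mul]
    have e2 : ∀ y, ∫ x, (Real.fourierChar (-inner ℝ x ξ) : ℂ) * ρ (x - y)
        = (Real.fourierChar (-inner ℝ y ξ) : ℂ) * 𝓕 ρ ξ := by
      intro y
      rw [Real.fourier_eq, ← integral_const_mul, ← integral_add_right_eq_self _ y]
      refine integral_congr_ae (Eventually.of_forall fun x => ?_)
      simp only [Circle.smul_def, smul_eq_mul, ← mul_assoc, add_sub_cancel_right]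
      congr 1
      rw [← Circle.coe_mul, ← AddChar.map_add_eq_mul]
      congr 2
      rw [inner_add_left]
      ring
    rw [e1, integral_integral_swap hint2]
    simp only [e2]
    rw [integral_mul_const, enorm_mul, charFun_apply]
    congr 2
    refine integral_congr_ae (Eventually.of_forall fun x => ?_)
    simp only [Real.fourierChar_apply, inner_smul_right]
    congr 2
    push_cast
    ring
  refine ⟨χ, hχd, ?_, ?_, ?_⟩
  · refine HasCompactSupport.of_support_subset_isCompact
      (isCompact_closedBall (0 : Rn n) (r + |R| + 1 + |R|)) fun x hx => ?_
    by_contra hx'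
    apply hx
    rw [hχx]
    refine integral_eq_zero_of_ae ?_
    filter_upwards [hR] with y hy
    have h1 : r + |R| + 1 + |R| < ‖x‖ := by simpa using hx'
    have h2 : b (x - y) = 0 := by
      refine b.zero_of_le_dist ?_
      rw [dist_zero_right]
      have := norm_sub_norm_le x y
      have := le_abs_self R
      change r + |R| + 1 ≤ _
      linarith
    simp [hρ, h2]
  · intro x hx
    rw [hχx]
    have : ∀ᵐ y ∂μ, ρ (x - y) = 1 := by
      filter_upwards [hR] with y hy
      have h2 : b (x - y) = 1 := by
        refine b.one_of_mem_closedBall ?_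
        rw [mem_closedBall_zero_iff]
        have h3 := norm_sub_le x y
        have h4 := le_abs_self R
        have h5 := hr x hx
        change _ ≤ r + |R|
        linarith
      simp [hρ, h2]
    rw [integral_congr_ae this]
    simp
  · intro l hl
    obtain ⟨C, hC0, hC⟩ := hchar l hl
    have hle : fourierNorm ω l χ ≤ ∫⁻ ξ, ENNReal.ofReal C * ‖𝓕 ρ ξ‖ₑ := by
      refine lintegral_mono fun ξ => ?_
      rw [hFχ]
      have h1 : ‖charFun μ (-(2 * Real.pi) • ξ)‖ₑ * ENNReal.ofReal (Real.exp (l * ω ‖ξ‖))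
          ≤ ENNReal.ofReal C := by
        rw [← ofReal_norm, ← ENNReal.ofReal_mul (norm_nonneg _)]
        refine ENNReal.ofReal_le_ofReal ?_
        have h2 : ‖ξ‖ ≤ ‖-(2 * Real.pi) • ξ‖ := by
          rw [norm_smul, norm_neg, Real.norm_of_nonneg Real.two_pi_pos.le]
          nlinarith [norm_nonneg ξ, Real.pi_gt_three]
        have h3 := weight_mono ω (norm_nonneg _) h2
        calc _ ≤ (C * Real.exp (-(l * ω ‖-(2 * Real.pi) • ξ‖))) * Real.exp (l * ω ‖ξ‖) := by
              gcongr
              exact hC _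
          _ ≤ (C * Real.exp (-(l * ω ‖ξ‖))) * Real.exp (l * ω ‖ξ‖) := by
              gcongr
          _ = C := by
              rw [mul_assoc, ← Real.exp_add]
              simp
      calc _ = (‖charFun μ (-(2 * Real.pi) • ξ)‖ₑ * ENNReal.ofReal (Real.exp (l * ω ‖ξ‖)))
            * ‖𝓕 ρ ξ‖ₑ := by ring
        _ ≤ _ := by gcongr
    refine hle.trans_lt ?_
    rw [lintegral_const_mul' _ _ (by simp)]
    exact ENNReal.mul_lt_top (by simp) hFi.2

/-! ### Test functions and ultradifferentiable functions -/

/-- The two types of regularity: Beurling `(ω)` and Roumieu `{ω}`. -/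
inductive UltraType where
  | beurling
  | roumieu

/-- Test functions, i.e. the elements of `𝓓^(ω)(ℝⁿ)`, respectively of `𝓓^{ω}(ℝⁿ)`. -/
def IsTest : UltraType → (Rn n → ℂ) → Prop
  | .beurling, φ => ContDiff ℝ (⊤ : ℕ∞) φ ∧ HasCompactSupport φ ∧
      ∀ l : ℝ, 0 < l → fourierNorm ω l φ < ∞
  | .roumieu, φ => ContDiff ℝ (⊤ : ℕ∞) φ ∧ HasCompactSupport φ ∧
      ∃ l : ℝ, 0 < l ∧ fourierNorm ω l φ < ∞

/-- Ultradifferentiable functions, i.e. the elements of `𝓔^(ω)(ℝⁿ)`, respectively `𝓔^{ω}(ℝⁿ)`: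
smooth functions whose product with every test function is a test function. -/
def IsUltradiff (T : UltraType) (f : Rn n → ℂ) : Prop :=
  ContDiff ℝ (⊤ : ℕ∞) f ∧ ∀ φ, IsTest ω T φ → IsTest ω T (φ * f)

/-- The local norm `‖f‖_{K,l}`: the infimum of the weighted Fourier norms of `φ f` over all test
functions `φ` with `φ = 1` on `K`. -/
noncomputable def compactNorm (T : UltraType) (K : Set (Rn n)) (l : ℝ) (f : Rn n → ℂ) : ℝ≥0∞ :=
  ⨅ (φ : Rn n → ℂ) (_ : IsTest ω T φ ∧ ∀ x ∈ K, φ x = 1), fourierNorm ω l (φ * f)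

variable {ω} {T : UltraType}

theorem IsTest.contDiff {φ : Rn n → ℂ} (h : IsTest ω T φ) : ContDiff ℝ (⊤ : ℕ∞) φ := by
  cases T <;> exact h.1

theorem IsTest.hasCompactSupport {φ : Rn n → ℂ} (h : IsTest ω T φ) : HasCompactSupport φ := by
  cases T <;> exact h.2.1

theorem IsTest.integrable_mul {φ f : Rn n → ℂ} (h : IsTest ω T φ) (hf : Continuous f) :
    Integrable (φ * f) :=
  (h.contDiff.continuous.mul hf).integrable_of_hasCompactSupport h.hasCompactSupport.mul_right

theorem IsTest.integrable {φ : Rn n → ℂ} (h : IsTest ω T φ) : Integrable φ :=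
  h.contDiff.continuous.integrable_of_hasCompactSupport h.hasCompactSupport

theorem isTest_of_all {φ : Rn n → ℂ} (h1 : ContDiff ℝ (⊤ : ℕ∞) φ) (h2 : HasCompactSupport φ)
    (h3 : ∀ l : ℝ, 0 ≤ l → fourierNorm ω l φ < ∞) : IsTest ω T φ := by
  cases T
  · exact ⟨h1, h2, fun l hl => h3 l hl.le⟩
  · exact ⟨h1, h2, 1, one_pos, h3 1 zero_le_one⟩

theorem IsTest.add {φ ψ : Rn n → ℂ} (h : IsTest ω T φ) (h' : IsTest ω T ψ) :
    IsTest ω T (φ + ψ) := by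
  have h1 := h.contDiff.add h'.contDiff
  have h2 := h.hasCompactSupport.add h'.hasCompactSupport
  have h3 := fun l => fourierNorm_add_le ω l h.integrable h'.integrable
  cases T
  · exact ⟨h1, h2, fun l hl => (h3 l).trans_lt (ENNReal.add_lt_top.2 ⟨h.2.2 l hl, h'.2.2 l hl⟩)⟩
  · obtain ⟨l, hl, hfl⟩ := h.2.2
    obtain ⟨m, hm, hfm⟩ := h'.2.2
    exact ⟨h1, h2, min l m, lt_min hl hm, (h3 _).trans_lt (ENNReal.add_lt_top.2
      ⟨(fourierNorm_mono ω (min_le_left _ _) _).trans_lt hfl,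
        (fourierNorm_mono ω (min_le_right _ _) _).trans_lt hfm⟩)⟩

theorem IsTest.smul {φ : Rn n → ℂ} (h : IsTest ω T φ) (c : ℂ) : IsTest ω T (c • φ) := by
  have h1 : ContDiff ℝ (⊤ : ℕ∞) (c • φ) := contDiff_const.smul h.contDiff
  have h2 : HasCompactSupport (c • φ) := h.hasCompactSupport.smul_left (f := fun _ => c)
  have h3 : ∀ l, fourierNorm ω l φ < ∞ → fourierNorm ω l (c • φ) < ∞ := fun l hl => by
    rw [fourierNorm_smul]
    exact ENNReal.mul_lt_top (by simp) hl
  cases T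
  · exact ⟨h1, h2, fun l hl => h3 l (h.2.2 l hl)⟩
  · obtain ⟨l, hl, hfl⟩ := h.2.2
    exact ⟨h1, h2, l, hl, h3 l hfl⟩

theorem IsTest.mul {φ ψ : Rn n → ℂ} (h : IsTest ω T φ) (h' : IsTest ω T ψ) :
    IsTest ω T (φ * ψ) := by
  have h1 := h.contDiff.mul h'.contDiff
  have h2 : HasCompactSupport (φ * ψ) := h.hasCompactSupport.mul_right
  have h3 : ∀ l, 0 < l → fourierNorm ω l φ < ∞ → fourierNorm ω l ψ < ∞ →
      fourierNorm ω l (φ * ψ) < ∞ := fun l hl hφ hψ =>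
    (fourierNorm_mul_le ω hl.le h.contDiff.continuous h.integrable h'.integrable
      hφ.ne).trans_lt (ENNReal.mul_lt_top hφ hψ)
  cases T
  · exact ⟨h1, h2, fun l hl => h3 l hl (h.2.2 l hl) (h'.2.2 l hl)⟩
  · obtain ⟨l, hl, hfl⟩ := h.2.2
    obtain ⟨m, hm, hfm⟩ := h'.2.2
    exact ⟨h1, h2, min l m, lt_min hl hm, h3 _ (lt_min hl hm)
      ((fourierNorm_mono ω (min_le_left _ _) _).trans_lt hfl)
      ((fourierNorm_mono ω (min_le_right _ _) _).trans_lt hfm)⟩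

theorem IsTest.translate {φ : Rn n → ℂ} (h : IsTest ω T φ) (x : Rn n) :
    IsTest ω T (fun y => φ (y + x)) := by
  have h1 : ContDiff ℝ (⊤ : ℕ∞) (fun y => φ (y + x)) :=
    h.contDiff.comp (contDiff_id.add contDiff_const)
  have h2 : HasCompactSupport (fun y => φ (y + x)) :=
    h.hasCompactSupport.comp_homeomorph (Homeomorph.addRight x)
  have h3 := fun l => fourierNorm_translate ω l φ x
  cases T
  · exact ⟨h1, h2, fun l hl => (h3 l).trans_lt (h.2.2 l hl)⟩
  · obtain ⟨l, hl, hfl⟩ := h.2.2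
    exact ⟨h1, h2, l, hl, (h3 l).trans_lt hfl⟩

theorem IsUltradiff.continuous {f : Rn n → ℂ} (h : IsUltradiff ω T f) : Continuous f :=
  h.1.continuous

theorem IsUltradiff.translate {f : Rn n → ℂ} (h : IsUltradiff ω T f) (x : Rn n) :
    IsUltradiff ω T (fun y => f (y + x)) := by
  refine ⟨h.1.comp (contDiff_id.add contDiff_const), fun φ hφ => ?_⟩
  have := (h.2 _ (hφ.translate (-x))).translate x
  simpa [Pi.mul_def] using this

theorem isUltradiff_const (c : ℂ) : IsUltradiff ω T (fun _ : Rn n => c) := by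
  refine ⟨contDiff_const, fun φ hφ => ?_⟩
  have : φ * (fun _ : Rn n => c) = c • φ := by
    ext x
    simp [mul_comm]
  rw [this]
  exact hφ.smul c

variable (ω T) in
/-- The algebra of ultradifferentiable functions of the given type on `ℝⁿ`. -/
def ultradiff (n : ℕ) : Subalgebra ℂ (Rn n → ℂ) where
  carrier := {f | IsUltradiff ω T f}
  mul_mem' := by
    rintro f g hf hg
    refine ⟨hf.1.mul hg.1, fun φ hφ => ?_⟩
    obtain ⟨χ, h1, h2, h3, h4⟩ := exists_cutoff ω hφ.hasCompactSupport
    have hχ : IsTest ω T χ := isTest_of_all h1 h2 h4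
    have : φ * (f * g) = (φ * f) * (χ * g) := by
      ext x
      by_cases hx : x ∈ tsupport φ
      · simp [h3 x hx, mul_assoc]
      · simp [image_eq_zero_of_notMem_tsupport hx]
    rw [this]
    exact (hf.2 φ hφ).mul (hg.2 χ hχ)
  add_mem' := by
    rintro f g hf hg
    refine ⟨hf.1.add hg.1, fun φ hφ => ?_⟩
    rw [mul_add]
    exact (hf.2 φ hφ).add (hg.2 φ hφ)
  algebraMap_mem' := fun c => isUltradiff_const c

/-! ### Properties of the local norms -/

theorem compactNorm_le {K : Set (Rn n)} {l : ℝ} {f φ : Rn n → ℂ} (hφ : IsTest ω T φ)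
    (h1 : ∀ x ∈ K, φ x = 1) : compactNorm ω T K l f ≤ fourierNorm ω l (φ * f) :=
  iInf₂_le φ ⟨hφ, h1⟩

theorem compactNorm_mono {K : Set (Rn n)} {l m : ℝ} (h : l ≤ m) (f : Rn n → ℂ) :
    compactNorm ω T K l f ≤ compactNorm ω T K m f :=
  iInf₂_mono fun _ _ => fourierNorm_mono ω h _

theorem enorm_le_compactNorm {l : ℝ} (hl : 0 ≤ l) {f : Rn n → ℂ} (hf : Continuous f) (x : Rn n) :
    ‖f x‖ₑ ≤ compactNorm ω T {x} l f := by
  refine le_iInf₂ fun φ hφ => ?_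
  have := enorm_le_fourierNorm ω hl (hφ.1.contDiff.continuous.mul hf) (hφ.1.integrable_mul hf) x
  rw [Pi.mul_apply, hφ.2 x rfl, one_mul] at this
  exact this

theorem compactNorm_translate_le (K : Set (Rn n)) (l : ℝ) (f : Rn n → ℂ) (x : Rn n) :
    compactNorm ω T K l (fun y => f (y + x)) ≤ compactNorm ω T ((fun y => y + x) '' K) l f := by
  refine le_iInf₂ fun φ hφ => ?_
  refine (compactNorm_le (hφ.1.translate x) fun y hy => hφ.2 _ ⟨y, hy, rfl⟩).trans ?_
  rw [← fourierNorm_translate ω l (φ * f) x]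
  exact le_rfl

variable (ω T) in
theorem exists_local_bound {K : Set (Rn n)} (hK : IsCompact K) :
    ∃ χ : Rn n → ℂ, IsTest ω T χ ∧ (∀ x ∈ K, χ x = 1) ∧ (∀ l : ℝ, 0 ≤ l → fourierNorm ω l χ < ∞) ∧
      ∃ K' : Set (Rn n), IsCompact K' ∧ ∀ l : ℝ, 0 ≤ l → ∃ C : ℝ≥0∞, C ≠ ∞ ∧
        ∀ f : Rn n → ℂ, Continuous f →
          fourierNorm ω l (χ * f) ≤ C * compactNorm ω T K' l f := by
  obtain ⟨χ, h1, h2, h3, h4⟩ := exists_cutoff ω hK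
  have hχ : IsTest ω T χ := isTest_of_all h1 h2 h4
  refine ⟨χ, hχ, h3, h4, tsupport χ, h2, fun l hl =>
    ⟨fourierNorm ω l χ + 1, by simp [(h4 l hl).ne], fun f hf => ?_⟩⟩
  unfold compactNorm
  have hC : fourierNorm ω l χ + 1 ≠ ∞ := by simp [(h4 l hl).ne]
  rw [ENNReal.mul_iInf_of_ne (by simp) hC]
  refine le_iInf fun φ => ?_
  rw [ENNReal.mul_iInf_of_ne (by simp) hC]
  refine le_iInf fun hφ => ?_
  have e : χ * f = χ * (φ * f) := by
    ext x
    by_cases hx : x ∈ tsupport χ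
    · simp [hφ.2 x hx]
    · simp [image_eq_zero_of_notMem_tsupport hx]
  rw [e]
  refine (fourierNorm_mul_le ω hl h1.continuous hχ.integrable (hφ.1.integrable_mul hf)
    (h4 l hl).ne).trans ?_
  gcongr
  exact le_self_add

variable (ω T) in
theorem exists_compactNorm_add_le {K : Set (Rn n)} (hK : IsCompact K) :
    ∃ K' : Set (Rn n), IsCompact K' ∧ ∀ l : ℝ, 0 ≤ l → ∃ C : ℝ≥0∞, C ≠ ∞ ∧
      ∀ f g : Rn n → ℂ, Continuous f → Continuous g → compactNorm ω T K l (f + g) ≤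
        C * compactNorm ω T K' l f + C * compactNorm ω T K' l g := by
  obtain ⟨χ, hχ, h1, -, K', hK', h⟩ := exists_local_bound ω T hK
  refine ⟨K', hK', fun l hl => ?_⟩
  obtain ⟨C, hC, hb⟩ := h l hl
  refine ⟨C, hC, fun f g hf hg => (compactNorm_le hχ h1).trans ?_⟩
  rw [mul_add]
  refine (fourierNorm_add_le ω l (hχ.integrable_mul hf) (hχ.integrable_mul hg)).trans ?_
  exact add_le_add (hb f hf) (hb g hg)

variable (ω T) in
theorem exists_compactNorm_mul_le {K : Set (Rn n)} (hK : IsCompact K) :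
    ∃ K' : Set (Rn n), IsCompact K' ∧ ∀ l : ℝ, 0 ≤ l → ∃ C : ℝ≥0∞, C ≠ ∞ ∧
      ∀ f g : Rn n → ℂ, Continuous f → Continuous g → compactNorm ω T K l (f * g) ≤
        (C * compactNorm ω T K' l f) * (C * compactNorm ω T K' l g) := by
  obtain ⟨χ, hχ, h1, -, K', hK', h⟩ := exists_local_bound ω T hK
  refine ⟨K', hK', fun l hl => ?_⟩
  obtain ⟨C, hC, hb⟩ := h l hl
  refine ⟨C, hC, fun f g hf hg => (compactNorm_le (hχ.mul hχ) fun x hx => by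
    simp [h1 x hx]).trans (le_trans ?_ (mul_le_mul' (hb f hf) (hb g hg)))⟩
  have cf := hχ.contDiff.continuous.mul hf
  have cg := hχ.contDiff.continuous.mul hg
  have jf := hχ.integrable_mul hf
  have jg := hχ.integrable_mul hg
  by_cases hf' : fourierNorm ω l (χ * f) = ∞
  · by_cases hg' : fourierNorm ω l (χ * g) = ∞
    · simp [hf', hg']
    · have e : χ * χ * (f * g) = (χ * g) * (χ * f) := by ring
      rw [e, mul_comm (fourierNorm ω l (χ * f))]
      exact fourierNorm_mul_le ω hl cg jg jf hg'
  · have e : χ * χ * (f * g) = (χ * f) * (χ * g) := by ring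
    rw [e]
    exact fourierNorm_mul_le ω hl cf jf jg hf'

variable (ω T) in
theorem exists_compactNorm_const_le {K : Set (Rn n)} (hK : IsCompact K) {l : ℝ} (hl : 0 ≤ l) :
    ∃ C : ℝ≥0∞, C ≠ ∞ ∧ ∀ c : ℂ, compactNorm ω T K l (fun _ => c) ≤ C * ‖c‖ₑ := by
  obtain ⟨χ, hχ, h1, h2, -⟩ := exists_local_bound ω T hK
  refine ⟨fourierNorm ω l χ, (h2 l hl).ne, fun c => (compactNorm_le hχ h1).trans ?_⟩
  have e : χ * (fun _ => c) = c • χ := by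
    ext x
    simp [mul_comm]
  rw [e, fourierNorm_smul, mul_comm]

/-! ### Growth with respect to `exp (k ω(1/ε))` as `ε → 0` -/

/-- The parameter set `(0, 1)` of the nets. -/
abbrev Param : Type := Set.Ioo (0 : ℝ) 1

variable (ω) in
/-- `F(ε) = o(exp (k ω(1/ε)))` as `ε → 0`. -/
def IsLittleOExp (k : ℝ) (F : Param → ℝ≥0∞) : Prop :=
  ∀ c : ℝ, 0 < c → ∀ᶠ ε in comap (Subtype.val : Param → ℝ) (𝓝 0),
    F ε ≤ ENNReal.ofReal (c * Real.exp (k * ω (1 / (ε : ℝ))))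

theorem IsLittleOExp.mono {k : ℝ} {F G : Param → ℝ≥0∞} (h : IsLittleOExp ω k G)
    (hFG : ∀ ε, F ε ≤ G ε) : IsLittleOExp ω k F := fun c hc =>
  (h c hc).mono fun ε hε => (hFG ε).trans hε

theorem IsLittleOExp.weaken {k k' : ℝ} {F : Param → ℝ≥0∞} (h : IsLittleOExp ω k F)
    (hk : k ≤ k') : IsLittleOExp ω k' F := fun c hc =>
  (h c hc).mono fun ε hε => hε.trans (ENNReal.ofReal_le_ofReal (by
    have h1 := weight_nonneg ω (one_div_nonneg.2 ε.2.1.le)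
    gcongr))

theorem IsLittleOExp.const_mul {k : ℝ} {F : Param → ℝ≥0∞} (h : IsLittleOExp ω k F)
    {C : ℝ≥0∞} (hC : C ≠ ∞) : IsLittleOExp ω k fun ε => C * F ε := by
  intro c hc
  have h0 : (0 : ℝ) < C.toReal + 1 := by positivity
  refine (h (c / (C.toReal + 1)) (by positivity)).mono fun ε hε => ?_
  have h1 : C ≤ ENNReal.ofReal (C.toReal + 1) := by
    rw [← ENNReal.ofReal_toReal hC]
    exact ENNReal.ofReal_le_ofReal (by rw [ENNReal.ofReal_toReal hC]; linarith)
  refine (mul_le_mul' h1 hε).trans ?_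
  rw [← ENNReal.ofReal_mul h0.le]
  refine ENNReal.ofReal_le_ofReal (le_of_eq ?_)
  field_simp

theorem IsLittleOExp.add {k : ℝ} {F G : Param → ℝ≥0∞} (hF : IsLittleOExp ω k F)
    (hG : IsLittleOExp ω k G) : IsLittleOExp ω k fun ε => F ε + G ε := by
  intro c hc
  filter_upwards [hF (c / 2) (by positivity), hG (c / 2) (by positivity)] with ε h1 h2
  refine (add_le_add h1 h2).trans ?_
  rw [← ENNReal.ofReal_add (by positivity) (by positivity)]
  refine ENNReal.ofReal_le_ofReal (le_of_eq ?_)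
  ring

theorem IsLittleOExp.mul {k k' : ℝ} {F G : Param → ℝ≥0∞} (hF : IsLittleOExp ω k F)
    (hG : IsLittleOExp ω k' G) : IsLittleOExp ω (k + k') fun ε => F ε * G ε := by
  intro c hc
  filter_upwards [hF c hc, hG 1 one_pos] with ε h1 h2
  refine (mul_le_mul' h1 h2).trans ?_
  rw [← ENNReal.ofReal_mul (by positivity)]
  refine ENNReal.ofReal_le_ofReal (le_of_eq ?_)
  rw [add_mul, Real.exp_add]
  ring

theorem tendsto_weight : Tendsto ω.toFun atTop atTop := by
  have h2 : Tendsto (fun t : ℝ => Real.log (1 + t)) atTop atTop :=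
    Real.tendsto_log_atTop.comp (tendsto_atTop_add_const_left _ _ tendsto_id)
  refine (ω.tendsto.atTop_mul_atTop₀ h2).congr' ?_
  filter_upwards [eventually_gt_atTop 0] with t ht
  have : Real.log (1 + t) ≠ 0 := (Real.log_pos (by linarith)).ne'
  field_simp

/-- A constant is `o(exp (k ω(1/ε)))` for `k > 0`. -/
theorem isLittleOExp_const {k : ℝ} (hk : 0 < k) {C : ℝ≥0∞} (hC : C ≠ ∞) :
    IsLittleOExp ω k fun _ => C := by
  intro c hc
  have h1 : Tendsto (fun t => c * Real.exp (k * ω t)) atTop atTop :=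
    (Real.tendsto_exp_atTop.comp (tendsto_weight.const_mul_atTop hk)).const_mul_atTop hc
  have h2 : Tendsto (fun ε : Param => 1 / (ε : ℝ)) (comap (Subtype.val : Param → ℝ) (𝓝 0))
      atTop := by
    simp only [one_div]
    refine tendsto_inv_nhdsGT_zero.comp (tendsto_nhdsWithin_iff.2 ⟨tendsto_comap, ?_⟩)
    exact Eventually.of_forall fun ε => ε.2.1
  filter_upwards [(h1.comp h2).eventually_ge_atTop C.toReal] with ε hε
  rw [← ENNReal.ofReal_toReal hC]
  exact ENNReal.ofReal_le_ofReal hε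

theorem isLittleOExp_zero (k : ℝ) : IsLittleOExp ω k fun _ => 0 := fun _ _ =>
  Eventually.of_forall fun _ => zero_le

/-! ### Generalized constants -/

variable (ω) in
/-- Moderate nets of complex numbers. -/
def IsModerateConst : UltraType → (Param → ℂ) → Prop
  | .beurling, r => ∃ k : ℝ, 0 < k ∧ IsLittleOExp ω k (fun ε => ‖r ε‖ₑ)
  | .roumieu, r => ∀ k : ℝ, 0 < k → IsLittleOExp ω k (fun ε => ‖r ε‖ₑ)

variable (ω) in
/-- Negligible nets of complex numbers. -/
def IsNegligibleConst : UltraType → (Param → ℂ) → Prop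
  | .beurling, r => ∀ k : ℝ, 0 < k → IsLittleOExp ω (-k) (fun ε => ‖r ε‖ₑ)
  | .roumieu, r => ∃ k : ℝ, 0 < k ∧ IsLittleOExp ω (-k) (fun ε => ‖r ε‖ₑ)

variable (ω T) in
/-- The algebra of moderate nets of complex numbers. -/
def moderateConst : Subalgebra ℂ (Param → ℂ) where
  carrier := {r | IsModerateConst ω T r}
  mul_mem' := by
    intro a b ha hb
    have e : ∀ ε, ‖(a * b) ε‖ₑ ≤ ‖a ε‖ₑ * ‖b ε‖ₑ := fun ε => by simp [enorm_mul]
    cases T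
    · obtain ⟨k, hk, h⟩ := ha
      obtain ⟨k', hk', h'⟩ := hb
      exact ⟨k + k', by positivity, (h.mul h').mono e⟩
    · intro k hk
      have := (ha (k / 2) (by positivity)).mul (hb (k / 2) (by positivity))
      rw [add_halves] at this
      exact this.mono e
  add_mem' := by
    intro a b ha hb
    have e : ∀ ε, ‖(a + b) ε‖ₑ ≤ ‖a ε‖ₑ + ‖b ε‖ₑ := fun ε => enorm_add_le _ _
    cases T
    · obtain ⟨k, hk, h⟩ := ha
      obtain ⟨k', hk', h'⟩ := hb
      exact ⟨k + k', by positivity, ((h.weaken (by linarith)).add (h'.weaken (by linarith))).mono e⟩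
    · exact fun k hk => ((ha k hk).add (hb k hk)).mono e
  algebraMap_mem' := by
    intro c
    have e : ∀ k, 0 < k → IsLittleOExp ω k (fun _ => ‖c‖ₑ) := fun k hk =>
      isLittleOExp_const hk (by simp)
    cases T
    · exact ⟨1, one_pos, e 1 one_pos⟩
    · exact e

variable (ω T) in
/-- The ideal of negligible nets of complex numbers. -/
def negligibleConst : Ideal (moderateConst ω T) where
  carrier := {r | IsNegligibleConst ω T r}
  add_mem' := by
    intro a b ha hb
    have e : ∀ ε, ‖(a.1 + b.1) ε‖ₑ ≤ ‖a.1 ε‖ₑ + ‖b.1 ε‖ₑ := fun ε => enorm_add_le _ _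
    cases T
    · exact fun k hk => ((ha k hk).add (hb k hk)).mono e
    · obtain ⟨k, hk, h⟩ := ha
      obtain ⟨k', hk', h'⟩ := hb
      exact ⟨min k k', lt_min hk hk', ((h.weaken (neg_le_neg (min_le_left _ _))).add
        (h'.weaken (neg_le_neg (min_le_right _ _)))).mono e⟩
  zero_mem' := by
    have e : ∀ k, IsLittleOExp ω k (fun _ => ‖(0 : ℂ)‖ₑ) := fun k =>
      (isLittleOExp_zero k).mono fun _ => by simp
    cases T
    · exact fun k _ => e (-k)
    · exact ⟨1, one_pos, e _⟩
  smul_mem' := by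
    intro a b ha
    have e : ∀ ε, ‖(a.1 * b.1) ε‖ₑ ≤ ‖a.1 ε‖ₑ * ‖b.1 ε‖ₑ := fun ε => by simp [enorm_mul]
    have hm := a.2
    cases T
    · obtain ⟨m, hm0, hm⟩ := hm
      intro k hk
      have := hm.mul (ha (k + m) (by positivity))
      exact (this.weaken (by linarith)).mono e
    · obtain ⟨k, hk, h⟩ := ha
      have := (hm (k / 2) (by positivity)).mul h
      exact ⟨k / 2, by positivity, (this.weaken (by linarith)).mono e⟩

variable (ω T) in
/-- The ring of generalized constants. -/
def GenConst : Type := moderateConst ω T ⧸ negligibleConst ω T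

noncomputable instance instCommRingGenConst : CommRing (GenConst ω T) :=
  Ideal.Quotient.commRing (negligibleConst ω T)

/-- The class `[(r_ε)]` of a moderate net of complex numbers. -/
noncomputable def GenConst.mk : moderateConst ω T →+* GenConst ω T :=
  Ideal.Quotient.mk (negligibleConst ω T)

/-! ### Generalized ultradifferentiable functions -/

variable (ω) in
/-- Moderate nets of functions. -/
def IsModerate : UltraType → (Param → Rn n → ℂ) → Prop
  | .beurling, g => ∀ K : Set (Rn n), IsCompact K → ∀ h : ℝ, 0 < h → ∃ k : ℝ, 0 < k ∧
      IsLittleOExp ω k (fun ε => compactNorm ω .beurling K h (g ε))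
  | .roumieu, g => ∀ K : Set (Rn n), IsCompact K → ∀ k : ℝ, 0 < k → ∃ h : ℝ, 0 < h ∧
      IsLittleOExp ω k (fun ε => compactNorm ω .roumieu K h (g ε))

variable (ω) in
/-- Negligible nets of functions. -/
def IsNegligible : UltraType → (Param → Rn n → ℂ) → Prop
  | .beurling, g => ∀ K : Set (Rn n), IsCompact K → ∀ h : ℝ, 0 < h → ∀ k : ℝ, 0 < k →
      IsLittleOExp ω (-k) (fun ε => compactNorm ω .beurling K h (g ε))
  | .roumieu, g => ∀ K : Set (Rn n), IsCompact K → ∃ k : ℝ, 0 < k ∧ ∃ h : ℝ, 0 < h ∧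
      IsLittleOExp ω (-k) (fun ε => compactNorm ω .roumieu K h (g ε))

theorem isModerate_const {r : Param → ℂ} (hr : IsModerateConst ω T r) :
    IsModerate ω T (fun ε (_ : Rn n) => r ε) := by
  cases T
  · intro K hK h hh
    obtain ⟨C, hC, hb⟩ := exists_compactNorm_const_le ω .beurling hK hh.le
    obtain ⟨k, hk, hr⟩ := hr
    exact ⟨k, hk, (hr.const_mul hC).mono fun ε => hb _⟩
  · intro K hK k hk
    obtain ⟨C, hC, hb⟩ := exists_compactNorm_const_le ω .roumieu hK zero_le_one
    exact ⟨1, one_pos, ((hr k hk).const_mul hC).mono fun ε => hb _⟩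

theorem isNegligible_const {r : Param → ℂ} (hr : IsNegligibleConst ω T r) :
    IsNegligible ω T (fun ε (_ : Rn n) => r ε) := by
  cases T
  · intro K hK h hh k hk
    obtain ⟨C, hC, hb⟩ := exists_compactNorm_const_le ω .beurling hK hh.le
    exact ((hr k hk).const_mul hC).mono fun ε => hb _
  · intro K hK
    obtain ⟨C, hC, hb⟩ := exists_compactNorm_const_le ω .roumieu hK zero_le_one
    obtain ⟨k, hk, hr⟩ := hr
    exact ⟨k, hk, 1, one_pos, (hr.const_mul hC).mono fun ε => hb _⟩

theorem IsModerate.point {g : Param → Rn n → ℂ} (hg : IsModerate ω T g)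
    (hc : ∀ ε, Continuous (g ε)) (x : Rn n) : IsModerateConst ω T (fun ε => g ε x) := by
  cases T
  · obtain ⟨k, hk, h⟩ := hg {x} isCompact_singleton 1 one_pos
    exact ⟨k, hk, h.mono fun ε => enorm_le_compactNorm zero_le_one (hc ε) x⟩
  · intro k hk
    obtain ⟨l, hl, h⟩ := hg {x} isCompact_singleton k hk
    exact h.mono fun ε => enorm_le_compactNorm hl.le (hc ε) x

theorem IsNegligible.point {g : Param → Rn n → ℂ} (hg : IsNegligible ω T g)
    (hc : ∀ ε, Continuous (g ε)) (x : Rn n) : IsNegligibleConst ω T (fun ε => g ε x) := by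
  cases T
  · exact fun k hk => (hg {x} isCompact_singleton 1 one_pos k hk).mono fun ε =>
      enorm_le_compactNorm zero_le_one (hc ε) x
  · obtain ⟨k, hk, l, hl, h⟩ := hg {x} isCompact_singleton
    exact ⟨k, hk, h.mono fun ε => enorm_le_compactNorm hl.le (hc ε) x⟩

theorem IsModerate.translate {g : Param → Rn n → ℂ} (hg : IsModerate ω T g) (x : Rn n) :
    IsModerate ω T (fun ε y => g ε (y + x)) := by
  have hK' : ∀ K : Set (Rn n), IsCompact K → IsCompact ((fun y => y + x) '' K) := fun K hK =>
    hK.image (by fun_prop)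
  cases T
  · intro K hK h hh
    obtain ⟨k, hk, hb⟩ := hg _ (hK' K hK) h hh
    exact ⟨k, hk, hb.mono fun ε => compactNorm_translate_le _ _ _ x⟩
  · intro K hK k hk
    obtain ⟨h, hh, hb⟩ := hg _ (hK' K hK) k hk
    exact ⟨h, hh, hb.mono fun ε => compactNorm_translate_le _ _ _ x⟩

theorem IsNegligible.translate {g : Param → Rn n → ℂ} (hg : IsNegligible ω T g) (x : Rn n) :
    IsNegligible ω T (fun ε y => g ε (y + x)) := by
  have hK' : ∀ K : Set (Rn n), IsCompact K → IsCompact ((fun y => y + x) '' K) := fun K hK =>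
    hK.image (by fun_prop)
  cases T
  · intro K hK h hh k hk
    exact (hg _ (hK' K hK) h hh k hk).mono fun ε => compactNorm_translate_le _ _ _ x
  · intro K hK
    obtain ⟨k, hk, h, hh, hb⟩ := hg _ (hK' K hK)
    exact ⟨k, hk, h, hh, hb.mono fun ε => compactNorm_translate_le _ _ _ x⟩

variable (ω T) in
/-- The algebra of moderate nets of ultradifferentiable functions. -/
def moderate (n : ℕ) : Subalgebra ℂ (Param → ultradiff ω T n) where
  carrier := {u | IsModerate ω T (fun ε => (u ε : Rn n → ℂ))}
  mul_mem' := by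
    intro a b ha hb
    cases T
    · intro K hK h hh
      obtain ⟨K', hK', hC⟩ := exists_compactNorm_mul_le ω .beurling hK
      obtain ⟨C, hC, e⟩ := hC h hh.le
      obtain ⟨k, hk, ha⟩ := ha K' hK' h hh
      obtain ⟨k', hk', hb⟩ := hb K' hK' h hh
      exact ⟨k + k', by positivity, ((ha.const_mul hC).mul (hb.const_mul hC)).mono fun ε =>
        e _ _ (a ε).2.continuous (b ε).2.continuous⟩
    · intro K hK k hk
      obtain ⟨K', hK', hC⟩ := exists_compactNorm_mul_le ω .roumieu hK
      obtain ⟨h, hh, ha⟩ := ha K' hK' (k / 2) (by positivity)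
      obtain ⟨h', hh', hb⟩ := hb K' hK' (k / 2) (by positivity)
      obtain ⟨C, hC, e⟩ := hC (min h h') (lt_min hh hh').le
      have ha' := ha.mono fun ε => compactNorm_mono (min_le_left h h') (a ε : Rn n → ℂ)
      have hb' := hb.mono fun ε => compactNorm_mono (min_le_right h h') (b ε : Rn n → ℂ)
      have := (ha'.const_mul hC).mul (hb'.const_mul hC)
      rw [add_halves] at this
      exact ⟨min h h', lt_min hh hh', this.mono fun ε =>
        e _ _ (a ε).2.continuous (b ε).2.continuous⟩
  add_mem' := by
    intro a b ha hb
    cases T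
    · intro K hK h hh
      obtain ⟨K', hK', hC⟩ := exists_compactNorm_add_le ω .beurling hK
      obtain ⟨C, hC, e⟩ := hC h hh.le
      obtain ⟨k, hk, ha⟩ := ha K' hK' h hh
      obtain ⟨k', hk', hb⟩ := hb K' hK' h hh
      exact ⟨k + k', by positivity, (((ha.const_mul hC).weaken (by linarith)).add
        ((hb.const_mul hC).weaken (by linarith))).mono fun ε =>
          e _ _ (a ε).2.continuous (b ε).2.continuous⟩
    · intro K hK k hk
      obtain ⟨K', hK', hC⟩ := exists_compactNorm_add_le ω .roumieu hK
      obtain ⟨h, hh, ha⟩ := ha K' hK' k hk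
      obtain ⟨h', hh', hb⟩ := hb K' hK' k hk
      obtain ⟨C, hC, e⟩ := hC (min h h') (lt_min hh hh').le
      have ha' := ha.mono fun ε => compactNorm_mono (min_le_left h h') (a ε : Rn n → ℂ)
      have hb' := hb.mono fun ε => compactNorm_mono (min_le_right h h') (b ε : Rn n → ℂ)
      exact ⟨min h h', lt_min hh hh', ((ha'.const_mul hC).add (hb'.const_mul hC)).mono fun ε =>
        e _ _ (a ε).2.continuous (b ε).2.continuous⟩
  algebraMap_mem' := fun c => isModerate_const ((moderateConst ω T).algebraMap_mem c)

variable (ω T) in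
/-- The ideal of negligible nets of ultradifferentiable functions. -/
def negligible (n : ℕ) : Ideal (moderate ω T n) where
  carrier := {u | IsNegligible ω T (fun ε => (u.1 ε : Rn n → ℂ))}
  add_mem' := by
    intro a b ha hb
    cases T
    · intro K hK h hh k hk
      obtain ⟨K', hK', hC⟩ := exists_compactNorm_add_le ω .beurling hK
      obtain ⟨C, hC, e⟩ := hC h hh.le
      exact (((ha K' hK' h hh k hk).const_mul hC).add
        ((hb K' hK' h hh k hk).const_mul hC)).mono fun ε =>
          e _ _ (a.1 ε).2.continuous (b.1 ε).2.continuous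
    · intro K hK
      obtain ⟨K', hK', hC⟩ := exists_compactNorm_add_le ω .roumieu hK
      obtain ⟨k, hk, h, hh, ha⟩ := ha K' hK'
      obtain ⟨k', hk', h', hh', hb⟩ := hb K' hK'
      obtain ⟨C, hC, e⟩ := hC (min h h') (lt_min hh hh').le
      have ha' := (ha.mono fun ε => compactNorm_mono (min_le_left h h')
        (a.1 ε : Rn n → ℂ)).weaken (neg_le_neg (min_le_left k k'))
      have hb' := (hb.mono fun ε => compactNorm_mono (min_le_right h h')
        (b.1 ε : Rn n → ℂ)).weaken (neg_le_neg (min_le_right k k'))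
      exact ⟨min k k', lt_min hk hk', min h h', lt_min hh hh',
        ((ha'.const_mul hC).add (hb'.const_mul hC)).mono fun ε =>
          e _ _ (a.1 ε).2.continuous (b.1 ε).2.continuous⟩
  zero_mem' := isNegligible_const (r := 0) (negligibleConst ω T).zero_mem
  smul_mem' := by
    intro a b hb
    have ha := a.2
    cases T
    · intro K hK h hh k hk
      obtain ⟨K', hK', hC⟩ := exists_compactNorm_mul_le ω .beurling hK
      obtain ⟨C, hC, e⟩ := hC h hh.le
      obtain ⟨m, hm, ha⟩ := ha K' hK' h hh
      have := (ha.const_mul hC).mul ((hb K' hK' h hh (k + m) (by positivity)).const_mul hC)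
      exact (this.weaken (by linarith)).mono fun ε =>
        e _ _ (a.1 ε).2.continuous (b.1 ε).2.continuous
    · intro K hK
      obtain ⟨K', hK', hC⟩ := exists_compactNorm_mul_le ω .roumieu hK
      obtain ⟨k, hk, h', hh', hb⟩ := hb K' hK'
      obtain ⟨h, hh, ha⟩ := ha K' hK' (k / 2) (by positivity)
      obtain ⟨C, hC, e⟩ := hC (min h h') (lt_min hh hh').le
      have ha' := ha.mono fun ε => compactNorm_mono (min_le_left h h') (a.1 ε : Rn n → ℂ)
      have hb' := hb.mono fun ε => compactNorm_mono (min_le_right h h') (b.1 ε : Rn n → ℂ)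
      have := (ha'.const_mul hC).mul (hb'.const_mul hC)
      exact ⟨k / 2, by positivity, min h h', lt_min hh hh', (this.weaken (by linarith)).mono fun ε =>
        e _ _ (a.1 ε).2.continuous (b.1 ε).2.continuous⟩

instance instCommRingModerate (n : ℕ) : CommRing (moderate ω T n) :=
  Subalgebra.toCommRing (moderate ω T n)

variable (ω T) in
/-- The algebra of generalized ultradifferentiable functions on `ℝⁿ`:
`𝓖^(ω)(ℝⁿ)` in the Beurling case and `𝓖^{ω}(ℝⁿ)` in the Roumieu case. -/
def GenFun (n : ℕ) : Type := moderate ω T n ⧸ negligible ω T n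

noncomputable instance instCommRingGenFun (n : ℕ) : CommRing (GenFun ω T n) :=
  Ideal.Quotient.commRing (negligible ω T n)

/-- The class `[(g_ε)]` of a moderate net of functions. -/
noncomputable def GenFun.mk : moderate ω T n →+* GenFun ω T n :=
  Ideal.Quotient.mk (negligible ω T n)

/-- Translation `(g_ε) ↦ (g_ε(· + x))` of moderate nets. -/
def moderateTranslate (x : Rn n) : moderate ω T n →+* moderate ω T n where
  toFun u := ⟨fun ε => ⟨fun y => (u.1 ε : Rn n → ℂ) (y + x), (u.1 ε).2.translate x⟩, u.2.translate x⟩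
  map_one' := rfl
  map_mul' _ _ := rfl
  map_zero' := rfl
  map_add' _ _ := rfl

/-- Translation `f ↦ f(· + x)` of generalized ultradifferentiable functions. -/
noncomputable def translate (x : Rn n) : GenFun ω T n →+* GenFun ω T n :=
  Ideal.quotientMap (negligible ω T n) (moderateTranslate x) (fun _ hu => IsNegligible.translate hu x)

/-- The net of values `(g_ε(x))` of a moderate net of functions. -/
def moderatePointValue (x : Rn n) : moderate ω T n →+* moderateConst ω T where
  toFun u := ⟨fun ε => (u.1 ε : Rn n → ℂ) x, u.2.point (fun ε => (u.1 ε).2.continuous) x⟩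
  map_one' := rfl
  map_mul' _ _ := rfl
  map_zero' := rfl
  map_add' _ _ := rfl

/-- The value `f(x) = [(f_ε(x))]` of a generalized ultradifferentiable function, which is a
generalized constant. -/
noncomputable def pointValue (x : Rn n) : GenFun ω T n →+* GenConst ω T :=
  Ideal.quotientMap (negligibleConst ω T) (moderatePointValue x)
    (fun u hu => IsNegligible.point hu (fun ε => (u.1 ε).2.continuous) x)

/-- The net of constant functions given by a moderate net of complex numbers. -/
def moderateOfConst (n : ℕ) : moderateConst ω T →+* moderate ω T n where
  toFun r := ⟨fun ε => ⟨fun _ => r.1 ε, isUltradiff_const _⟩, isModerate_const r.2⟩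
  map_one' := rfl
  map_mul' _ _ := rfl
  map_zero' := rfl
  map_add' _ _ := rfl

/-- The canonical embedding of generalized constants into generalized ultradifferentiable
functions. -/
noncomputable def ofConst (n : ℕ) : GenConst ω T →+* GenFun ω T n :=
  Ideal.quotientMap (negligible ω T n) (moderateOfConst n) (fun _ hr => isNegligible_const hr)

theorem GenFun.mk_surjective : Function.Surjective (GenFun.mk (ω := ω) (T := T) (n := n)) :=
  Ideal.Quotient.mk_surjective

theorem GenFun.mk_eq_zero_iff (u : moderate ω T n) :
    GenFun.mk u = 0 ↔ IsNegligible ω T (fun ε => (u.1 ε : Rn n → ℂ)) :=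
  Ideal.Quotient.eq_zero_iff_mem

theorem translate_mk (x : Rn n) (u : moderate ω T n) :
    translate x (GenFun.mk u) = GenFun.mk (moderateTranslate x u) := rfl

theorem pointValue_mk (x : Rn n) (u : moderate ω T n) :
    pointValue x (GenFun.mk u) = GenConst.mk (moderatePointValue x u) := rfl

theorem ofConst_mk (r : moderateConst ω T) :
    ofConst n (GenConst.mk r) = GenFun.mk (moderateOfConst n r) := rfl

end Ultra

/-! Write `g` for a representative of the class. The claim is that the moderate net `g ε - g ε 0` is
negligible. The hypothesis, evaluated at the origin, says that `g ε x - g ε 0` is small for each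
fixed `x`, but with a threshold in `ε` (and, in the Roumieu case, an exponent) that depends on `x`,
and with no information on higher norms. Two independent arguments remove these defects.

Higher norms are free for moderate nets. Since `exp (l w) ≤ δ exp ((2l+a) w) + δ⁻¹ exp (-a w)`, the
norm of index `l` of a cut-off function is at most `δ` times its norm of index `2l+a` plus `δ⁻¹`
times a multiple of a uniform norm; the multiple is finite because `ω` outgrows the logarithm, which
makes `exp (-a ω(|ξ|))` integrable (`exists_compactNorm_le_interpolation`). Taking for `δ` a
negative power of `exp (ω(1/ε))` absorbs the moderate growth of the strong norm, so smallness in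
uniform norms on compact sets implies negligibility.

Uniformity comes from Baire's theorem (`exists_ball_eventually_le`): the pointwise estimates hold
with one exponent and one threshold on some ball. The hypothesis for a single shift, which is
locally uniform in the base point, carries the estimate from this ball to a ball of the same radius
around any other point, and a compact set is covered by finitely many of these
(`exists_isLittleOExp_supNorm_sub`). -/

namespace Ultra

section Nullity

variable {n : ℕ} {ω : WeightFunction} {T : UltraType}

/-! ### Interpolation between the weighted Fourier norms and the uniform norm -/

-- For large `t` one has `a ω(t) ≥ (n+1) log (1+t)`, so the integrand is eventually below
-- `(1+|ξ|)^(-(n+1))`, which is integrable in dimension `n`.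
variable (ω n) in
theorem lintegral_exp_neg_weight_lt_top {a : ℝ} (ha : 0 < a) :
    ∫⁻ ξ : Rn n, ENNReal.ofReal (Real.exp (-(a * ω ‖ξ‖))) < ∞ := by
  obtain ⟨R, hR⟩ := eventually_atTop.1 (ω.tendsto.eventually_ge_atTop (((n : ℝ) + 1) / a))
  -- The lower bound 1 keeps `log (1+‖ξ‖)` positive when `‖ξ‖ ≥ M`.
  set M : ℝ := max R 1 with hM
  have hM1 : 1 ≤ M := le_max_right _ _
  have hint : Integrable (fun ξ : Rn n => (1 + ‖ξ‖) ^ (-((n : ℝ) + 1))) :=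
    integrable_one_add_norm (by simp)
  -- The factor `(1+M)^(n+1)` serves the ball of radius `M`: there the left side is at most 1 and
  -- the right side at least 1.
  have hle : ∀ ξ : Rn n, Real.exp (-(a * ω ‖ξ‖)) ≤
      (1 + M) ^ ((n : ℝ) + 1) * (1 + ‖ξ‖) ^ (-((n : ℝ) + 1)) := by
    intro ξ
    have h0 := norm_nonneg ξ
    rcases le_total M ‖ξ‖ with h | h
    · have hlog : 0 < Real.log (1 + ‖ξ‖) := Real.log_pos (by linarith)
      have h1 := hR ‖ξ‖ ((le_max_left _ _).trans h)
      rw [div_le_div_iff₀ ha hlog] at h1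
      have h2 : Real.exp (-(a * ω ‖ξ‖)) ≤ (1 + ‖ξ‖) ^ (-((n : ℝ) + 1)) := by
        rw [Real.rpow_def_of_pos (by linarith)]
        gcongr
        linarith
      refine h2.trans (le_mul_of_one_le_left (by positivity) ?_)
      exact Real.one_le_rpow (by linarith) (by positivity)
    · have h1 : Real.exp (-(a * ω ‖ξ‖)) ≤ 1 := by
        have := weight_nonneg ω h0
        exact Real.exp_le_one_iff.2 (by nlinarith)
      refine h1.trans ?_
      rw [Real.rpow_neg (by positivity), ← div_eq_mul_inv, one_le_div (by positivity)]
      gcongr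
  refine lt_of_le_of_lt (lintegral_mono fun ξ => ENNReal.ofReal_le_ofReal (hle ξ)) ?_
  exact (hint.const_mul _).lintegral_lt_top

theorem enorm_fourier_le_lintegral (f : Rn n → ℂ) (ξ : Rn n) : ‖𝓕 f ξ‖ₑ ≤ ∫⁻ x, ‖f x‖ₑ := by
  rw [Real.fourier_eq]
  refine (enorm_integral_le_lintegral_enorm _).trans_eq (lintegral_congr fun x => ?_)
  exact enorm_circle_smul _ _

/-- The left side is the geometric mean of the two summands: their exponents `p` and `q` add up to
`2 l w`, so the larger one is at least `l w`. -/
theorem exp_le_weighted_add {δ : ℝ} (hδ : 0 < δ) (l a w : ℝ) :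
    Real.exp (l * w) ≤ δ * Real.exp ((2 * l + a) * w) + δ⁻¹ * Real.exp (-(a * w)) := by
  rw [← Real.exp_log hδ, ← Real.exp_neg, ← Real.exp_add, ← Real.exp_add]
  set p := Real.log δ + (2 * l + a) * w
  set q := -Real.log δ + -(a * w)
  rcases le_total (l * w) p with h | h
  · have := Real.exp_le_exp.2 h
    linarith [Real.exp_pos q]
  · have hq : l * w ≤ q := by
      have : p + q = 2 * (l * w) := by simp only [p, q]; ring
      linarith
    have := Real.exp_le_exp.2 hq
    linarith [Real.exp_pos p]

/-- Integrate `exp_le_weighted_add` against `|𝓕 f|`, and in the second term replace `|𝓕 f|` by the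
`L¹` norm of `f`. The loss `a` in the index pays for the convergence of the remaining integral. -/
theorem fourierNorm_le_interpolation {δ : ℝ} (hδ : 0 < δ) (l a : ℝ) (f : Rn n → ℂ) :
    fourierNorm ω l f ≤ ENNReal.ofReal δ * fourierNorm ω (2 * l + a) f +
      ENNReal.ofReal δ⁻¹ * ((∫⁻ x, ‖f x‖ₑ) *
        ∫⁻ ξ : Rn n, ENNReal.ofReal (Real.exp (-(a * ω ‖ξ‖)))) := by
  -- As `f` is arbitrary, `𝓕 f` need not be measurable and `∫⁻ ‖f‖ₑ` may be infinite; measurability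
  -- of the weight alone justifies moving this factor and the sum under the integral.
  have hm : Measurable fun ξ : Rn n => ENNReal.ofReal (Real.exp (-(a * ω ‖ξ‖))) := by
    simpa only [neg_mul] using measurable_expWeight (n := n) ω (-a)
  unfold fourierNorm
  rw [← lintegral_const_mul' _ _ (by simp), ← lintegral_const_mul _ hm,
    ← lintegral_const_mul' _ _ (by simp), ← lintegral_add_right _ ((hm.const_mul _).const_mul _)]
  refine lintegral_mono fun ξ => ?_
  have h : ENNReal.ofReal (Real.exp (l * ω ‖ξ‖)) ≤
      ENNReal.ofReal δ * ENNReal.ofReal (Real.exp ((2 * l + a) * ω ‖ξ‖)) +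
        ENNReal.ofReal δ⁻¹ * ENNReal.ofReal (Real.exp (-(a * ω ‖ξ‖))) := by
    rw [← ENNReal.ofReal_mul hδ.le, ← ENNReal.ofReal_mul (by positivity),
      ← ENNReal.ofReal_add (by positivity) (by positivity)]
    exact ENNReal.ofReal_le_ofReal (exp_le_weighted_add hδ l a _)
  calc _ ≤ ‖𝓕 f ξ‖ₑ * _ := mul_le_mul_right h _
    _ = ENNReal.ofReal δ * (‖𝓕 f ξ‖ₑ * ENNReal.ofReal (Real.exp ((2 * l + a) * ω ‖ξ‖))) +
        ENNReal.ofReal δ⁻¹ * (‖𝓕 f ξ‖ₑ * ENNReal.ofReal (Real.exp (-(a * ω ‖ξ‖)))) := by ring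
    _ ≤ _ := by
      gcongr
      exact enorm_fourier_le_lintegral f ξ

/-- The uniform norm on a set. -/
noncomputable def supNorm (K : Set (Rn n)) (f : Rn n → ℂ) : ℝ≥0∞ := ⨆ x ∈ K, ‖f x‖ₑ

theorem enorm_le_supNorm {K : Set (Rn n)} {x : Rn n} (hx : x ∈ K) (f : Rn n → ℂ) :
    ‖f x‖ₑ ≤ supNorm K f := le_iSup₂_of_le x hx le_rfl

/-- A cutoff equal to 1 on `K` is admissible for `{x}` whenever `x ∈ K`, so the pointwise bound from
Fourier inversion is uniform on `K`. -/
theorem supNorm_le_compactNorm {K : Set (Rn n)} {l : ℝ} (hl : 0 ≤ l) {f : Rn n → ℂ}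
    (hf : Continuous f) : supNorm K f ≤ compactNorm ω T K l f := by
  refine iSup₂_le fun x hx => (enorm_le_compactNorm (ω := ω) (T := T) hl hf x).trans ?_
  exact le_iInf₂ fun φ hφ => compactNorm_le hφ.1 fun y hy => by
    rw [Set.mem_singleton_iff.1 hy]
    exact hφ.2 x hx

variable (ω T) in
/-- The local norms are controlled by a small multiple of a stronger local norm and a large
multiple of a uniform norm. -/
theorem exists_compactNorm_le_interpolation {K : Set (Rn n)} (hK : IsCompact K) :
    ∃ K' : Set (Rn n), IsCompact K' ∧ ∀ l a : ℝ, 0 ≤ l → 0 < a → ∃ C : ℝ≥0∞, C ≠ ∞ ∧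
      ∀ f : Rn n → ℂ, Continuous f → ∀ δ : ℝ, 0 < δ → compactNorm ω T K l f ≤
        C * (ENNReal.ofReal δ * compactNorm ω T K' (2 * l + a) f) +
          C * (ENNReal.ofReal δ⁻¹ * supNorm K' f) := by
  obtain ⟨χ, hχ, h1, -, K', hK', h⟩ := exists_local_bound ω T hK
  -- `K'` controls the strong norm of `χ f`; the support of `χ` is added because the `L¹` norm of `χ
  -- f` is bounded through the supremum of `f` there.
  refine ⟨K' ∪ tsupport χ, hK'.union hχ.hasCompactSupport, fun l a hl ha => ?_⟩
  obtain ⟨C, hC, hb⟩ := h (2 * l + a) (by positivity)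
  set D : ℝ≥0∞ := (∫⁻ x, ‖χ x‖ₑ) * ∫⁻ ξ : Rn n, ENNReal.ofReal (Real.exp (-(a * ω ‖ξ‖))) with hD
  have hDt : D ≠ ∞ :=
    ENNReal.mul_ne_top hχ.integrable.2.ne (lintegral_exp_neg_weight_lt_top n ω ha).ne
  refine ⟨C + D, ENNReal.add_ne_top.2 ⟨hC, hDt⟩, fun f hf δ hδ => ?_⟩
  refine (compactNorm_le hχ h1).trans ((fourierNorm_le_interpolation hδ l a _).trans ?_)
  -- A larger compact set admits fewer cutoffs, so the infimum grows.
  have e1 : compactNorm ω T K' (2 * l + a) f ≤ compactNorm ω T (K' ∪ tsupport χ) (2 * l + a) f :=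
    le_iInf₂ fun φ hφ => compactNorm_le hφ.1 fun x hx => hφ.2 x (Or.inl hx)
  have e2 : ∫⁻ x, ‖(χ * f) x‖ₑ ≤ (∫⁻ x, ‖χ x‖ₑ) * supNorm (K' ∪ tsupport χ) f := by
    rw [← lintegral_mul_const _ hχ.contDiff.continuous.enorm.measurable]
    refine lintegral_mono fun x => ?_
    by_cases hx : x ∈ tsupport χ
    · rw [Pi.mul_apply, enorm_mul]
      gcongr
      exact enorm_le_supNorm (Or.inr hx) f
    · simp [image_eq_zero_of_notMem_tsupport hx]
  refine add_le_add ?_ ?_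
  · calc _ ≤ ENNReal.ofReal δ * (C * compactNorm ω T (K' ∪ tsupport χ) (2 * l + a) f) := by
          gcongr
          exact (hb f hf).trans (by gcongr)
      _ = C * (ENNReal.ofReal δ * compactNorm ω T (K' ∪ tsupport χ) (2 * l + a) f) := by ring
      _ ≤ _ := by
          gcongr
          exact le_self_add
  · calc _ ≤ ENNReal.ofReal δ⁻¹ * (((∫⁻ x, ‖χ x‖ₑ) * supNorm (K' ∪ tsupport χ) f) *
            ∫⁻ ξ : Rn n, ENNReal.ofReal (Real.exp (-(a * ω ‖ξ‖)))) := by gcongr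
      _ = D * (ENNReal.ofReal δ⁻¹ * supNorm (K' ∪ tsupport χ) f) := by rw [hD]; ring
      _ ≤ _ := by
          gcongr
          exact le_add_self

/-! ### Null characterization of negligibility -/

/-- Used with `δ` and `δ⁻¹` chosen as powers of `exp (ω(1/ε))`. The exponent shifts by exactly `s`;
`IsLittleOExp.mul` would lose something, as `exp (s ω)` is not little-o of itself. -/
theorem IsLittleOExp.exp_mul {k : ℝ} {F : Param → ℝ≥0∞} (h : IsLittleOExp ω k F) (s : ℝ) :
    IsLittleOExp ω (s + k) fun ε =>
      ENNReal.ofReal (Real.exp (s * ω (1 / (ε : ℝ)))) * F ε := by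
  intro c hc
  filter_upwards [h c hc] with ε hε
  refine (mul_le_mul_right hε _).trans ?_
  rw [← ENNReal.ofReal_mul (by positivity)]
  refine ENNReal.ofReal_le_ofReal (le_of_eq ?_)
  rw [add_mul, Real.exp_add]
  ring

/-- A moderate net is negligible as soon as it is negligible for the uniform norms on compact
sets: Beurling case. -/
theorem isNegligible_beurling_of_supNorm {g : Param → Rn n → ℂ} (hc : ∀ ε, Continuous (g ε))
    (hg : IsModerate ω .beurling g)
    (h : ∀ K : Set (Rn n), IsCompact K → ∀ k : ℝ, 0 < k →
      IsLittleOExp ω (-k) fun ε => supNorm K (g ε)) : IsNegligible ω .beurling g := by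
  intro K hK l hl k hk
  obtain ⟨K', hK', hb⟩ := exists_compactNorm_le_interpolation ω .beurling hK
  obtain ⟨C, hC, hb⟩ := hb l 1 hl.le one_pos
  obtain ⟨m, hm, hgm⟩ := hg K' hK' (2 * l + 1) (by positivity)
  -- The choice is `δ = exp (-(k+m) ω(1/ε))`. The strong norm contributes the exponent `-(k+m) + m =
  -- -k`, the uniform norm `(k+m) - (2k+m) = -k`.
  have h1 := (hgm.exp_mul (-(k + m))).const_mul hC
  have h2 := ((h K' hK' (2 * k + m) (by positivity)).exp_mul (k + m)).const_mul hC
  refine ((h1.weaken (by linarith)).add (h2.weaken (by linarith))).mono fun ε => ?_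
  refine (hb (g ε) (hc ε) _ (Real.exp_pos (-(k + m) * ω (1 / (ε : ℝ))))).trans_eq ?_
  rw [← Real.exp_neg, neg_mul, neg_neg]

/-- A moderate net is negligible as soon as it is negligible for the uniform norms on compact
sets: Roumieu case. -/
theorem isNegligible_roumieu_of_supNorm {g : Param → Rn n → ℂ} (hc : ∀ ε, Continuous (g ε))
    (hg : IsModerate ω .roumieu g)
    (h : ∀ K : Set (Rn n), IsCompact K → ∃ k : ℝ, 0 < k ∧
      IsLittleOExp ω (-k) fun ε => supNorm K (g ε)) : IsNegligible ω .roumieu g := by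
  intro K hK
  obtain ⟨K', hK', hb⟩ := exists_compactNorm_le_interpolation ω .roumieu hK
  obtain ⟨k, hk, h⟩ := h K' hK'
  -- The decay rate `k` is given, so the growth rate is taken smaller than it; moderateness then
  -- dictates the index `l`.
  obtain ⟨l, hl, hgm⟩ := hg K' hK' (k / 4) (by positivity)
  -- The strong norm must have the index `l` just obtained, so the target index is lowered instead.
  obtain ⟨C, hC, hb⟩ := hb (l / 4) (l / 2) (by positivity) (by positivity)
  rw [show 2 * (l / 4) + l / 2 = l by ring] at hb
  -- With `δ = exp (-(k/2) ω(1/ε))` the exponents are `-k/2 + k/4 = -k/4` and `k/2 - k = -k/2`; the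
  -- weaker one is kept.
  have h1 := (hgm.exp_mul (-(k / 2))).const_mul hC
  have h2 := (h.exp_mul (k / 2)).const_mul hC
  refine ⟨k / 4, by positivity, l / 4, by positivity,
    ((h1.weaken (by linarith)).add (h2.weaken (by linarith))).mono fun ε => ?_⟩
  refine (hb (g ε) (hc ε) _ (Real.exp_pos (-(k / 2) * ω (1 / (ε : ℝ))))).trans_eq ?_
  rw [← Real.exp_neg, neg_mul, neg_neg]

/-! ### Uniformity of translation invariance -/

/-- A bound by `exp (-k ω(1/ε))` for small `ε` implies `o(exp (-k' ω(1/ε)))` for `k' < k`. -/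
theorem isLittleOExp_of_eventually_le {k k' : ℝ} (hk : k < k') {F : Param → ℝ≥0∞}
    (h : ∀ᶠ ε in comap (Subtype.val : Param → ℝ) (𝓝 0),
      F ε ≤ ENNReal.ofReal (Real.exp (k * ω (1 / (ε : ℝ))))) : IsLittleOExp ω k' F := by
  -- The constant 1 is `o(exp ((k'-k) ω(1/ε)))`; multiply by `exp (k ω(1/ε))`.
  have h1 := (isLittleOExp_const (ω := ω) (sub_pos.2 hk) ENNReal.one_ne_top).exp_mul k
  rw [add_sub_cancel] at h1
  intro c hc
  filter_upwards [h, h1 c hc] with ε h2 h3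
  rw [mul_one] at h3
  exact h2.trans h3

/-- Pointwise estimates by countably many gauges are uniform on some ball, by Baire's theorem. -/
theorem exists_ball_eventually_le {g : Param → Rn n → ℂ} (hc : ∀ ε, Continuous (g ε))
    (κ : ℕ → ℝ)
    (h : ∀ x, ∃ m, ∀ᶠ ε in comap (Subtype.val : Param → ℝ) (𝓝 0),
      ‖g ε x‖ₑ ≤ ENNReal.ofReal (Real.exp (-κ m * ω (1 / (ε : ℝ))))) :
    ∃ (x : Rn n) (r : ℝ) (m : ℕ), 0 < r ∧ ∀ᶠ ε in comap (Subtype.val : Param → ℝ) (𝓝 0),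
      ∀ y ∈ Metric.ball x r, ‖g ε y‖ₑ ≤ ENNReal.ofReal (Real.exp (-κ m * ω (1 / (ε : ℝ)))) := by
  -- The pair records the gauge and the threshold `1/(j+1)` below which the estimate holds, which
  -- makes the cover countable. Plain inequalities instead of little-o make each set closed.
  set A : ℕ × ℕ → Set (Rn n) := fun p => ⋂ (ε : Param) (_ : (ε : ℝ) < 1 / ((p.2 : ℝ) + 1)),
    {x | ‖g ε x‖ₑ ≤ ENNReal.ofReal (Real.exp (-κ p.1 * ω (1 / (ε : ℝ))))} with hA
  have hAc : ∀ p, IsClosed (A p) := fun p => isClosed_iInter fun ε => isClosed_iInter fun _ =>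
    isClosed_le (hc ε).enorm continuous_const
  have hAu : ⋃ p, A p = Set.univ := by
    refine Set.eq_univ_of_forall fun x => ?_
    obtain ⟨m, hm⟩ := h x
    obtain ⟨s, hs, hm⟩ := mem_comap.1 hm
    obtain ⟨r, hr, hrs⟩ := Metric.mem_nhds_iff.1 hs
    obtain ⟨j, hj⟩ := exists_nat_one_div_lt hr
    refine Set.mem_iUnion.2 ⟨(m, j), Set.mem_iInter₂.2 fun ε hε => hm (hrs ?_)⟩
    rw [Metric.mem_ball, dist_zero_right, Real.norm_of_nonneg ε.2.1.le]
    exact lt_trans hε hj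
  obtain ⟨p, x, hx⟩ := nonempty_interior_of_iUnion_of_closed hAc hAu
  obtain ⟨r, hr, hxr⟩ := Metric.mem_nhds_iff.1 (mem_interior_iff_mem_nhds.1 hx)
  refine ⟨x, r, p.1, hr, ?_⟩
  have hp : (0 : ℝ) < 1 / ((p.2 : ℝ) + 1) := by positivity
  filter_upwards [preimage_mem_comap (Iio_mem_nhds hp)] with ε hε y hy
  exact Set.mem_iInter₂.1 (hxr hy) ε hε

/-- If the differences `g(· + x) - g` are small, locally uniformly for each `x`, then so is
`g - g(0)`. -/
theorem exists_isLittleOExp_supNorm_sub {g : Param → Rn n → ℂ} (hc : ∀ ε, Continuous (g ε))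
    {κ : ℕ → ℝ} (hκ : Antitone κ) (hκ0 : ∀ m, 0 < κ m)
    (h : ∀ (x : Rn n) (K : Set (Rn n)), IsCompact K → ∃ m, IsLittleOExp ω (-κ m) fun ε =>
      supNorm K fun y => g ε (y + x) - g ε y)
    {K : Set (Rn n)} (hK : IsCompact K) :
    ∃ m, IsLittleOExp ω (-(κ m / 2)) fun ε => supNorm K fun y => g ε y - g ε 0 := by
  obtain ⟨x, r, m, hr, hm⟩ := exists_ball_eventually_le (ω := ω)
    (g := fun ε y => g ε y - g ε 0) (fun ε => (hc ε).sub continuous_const) κ fun x => by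
      -- At the base point 0 the difference is `g ε x - g ε 0`.
      obtain ⟨m, hm⟩ := h x {0} isCompact_singleton
      refine ⟨m, (hm 1 one_pos).mono fun ε hε => le_trans ?_ (hε.trans_eq (by rw [one_mul]))⟩
      simpa using enorm_le_supNorm (Set.mem_singleton (0 : Rn n)) fun y => g ε (y + x) - g ε y
  -- Half of the exponent is given up to turn the plain bound back into a little-o.
  have hball : IsLittleOExp ω (-(κ m / 2)) fun ε =>
      supNorm (Metric.ball x r) fun y => g ε y - g ε 0 :=
    isLittleOExp_of_eventually_le (by linarith [hκ0 m]) (hm.mono fun ε hε => iSup₂_le hε)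
  -- A larger index is a weaker estimate, so two estimates combine at the maximum of their indices.
  have hle : ∀ {i j : ℕ}, i ≤ j → -(κ i / 2) ≤ -(κ j / 2) := fun hij => by linarith [hκ hij]
  refine hK.induction_on (p := fun K => ∃ m, IsLittleOExp ω (-(κ m / 2)) fun ε =>
    supNorm K fun y => g ε y - g ε 0) ?_ ?_ ?_ ?_
  · exact ⟨0, (isLittleOExp_zero _).mono fun ε => by simp [supNorm]⟩
  · intro s t hst ht
    obtain ⟨j, hj⟩ := ht
    exact ⟨j, hj.mono fun ε => biSup_mono hst⟩
  · intro s t hs ht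
    obtain ⟨i, hi⟩ := hs
    obtain ⟨j, hj⟩ := ht
    refine ⟨max i j, ((hi.weaken (hle (le_max_left _ _))).add
      (hj.weaken (hle (le_max_right _ _)))).mono fun ε => ?_⟩
    simp only [supNorm, iSup_union]
    exact sup_le le_self_add le_add_self
  · intro z hz
    refine ⟨Metric.ball z r, mem_nhdsWithin_of_mem_nhds (Metric.ball_mem_nhds z hr), ?_⟩
    -- The same shift `z - x` moves every point of the Baire ball into the ball around `z`, so one
    -- instance of the hypothesis suffices.
    obtain ⟨j, hj⟩ := h (z - x) _ (isCompact_closedBall x r)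
    have hj' := hj.weaken (k' := -(κ j / 2)) (by linarith [hκ0 j])
    refine ⟨max m j, ((hball.weaken (hle (le_max_left _ _))).add
      (hj'.weaken (hle (le_max_right _ _)))).mono fun ε => iSup₂_le fun y hy => ?_⟩
    have hy' : y - (z - x) ∈ Metric.ball x r := by
      rw [Metric.mem_ball, dist_eq_norm] at hy ⊢
      convert hy using 2
      abel
    have e : g ε y - g ε 0 = (g ε (y - (z - x)) - g ε 0) +
        (g ε (y - (z - x) + (z - x)) - g ε (y - (z - x))) := by
      rw [sub_add_cancel]
      ring
    change ‖g ε y - g ε 0‖ₑ ≤ _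
    rw [e]
    refine (enorm_add_le _ _).trans (add_le_add ?_ ?_)
    · exact enorm_le_supNorm hy' fun y => g ε y - g ε 0
    · exact enorm_le_supNorm (Metric.ball_subset_closedBall hy')
        fun y => g ε (y + (z - x)) - g ε y

/-- A translation invariant moderate net differs from its net of values at the origin by a
negligible net. -/
theorem isNegligible_sub_apply_zero {g : Param → Rn n → ℂ} (hc : ∀ ε, Continuous (g ε))
    (hm : IsModerate ω T fun ε y => g ε y - g ε 0)
    (h : ∀ x, IsNegligible ω T fun ε y => g ε (y + x) - g ε y) :
    IsNegligible ω T fun ε y => g ε y - g ε 0 := by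
  have hd : ∀ ε x, Continuous fun y => g ε (y + x) - g ε y := fun ε x =>
    ((hc ε).comp (by fun_prop)).sub (hc ε)
  have hd0 : ∀ ε, Continuous fun y => g ε y - g ε 0 := fun ε => (hc ε).sub continuous_const
  cases T
  -- Every exponent is available at every point, so the gauge is constant and only the threshold
  -- varies in Baire's theorem; `2 * k` anticipates the halving.
  · refine isNegligible_beurling_of_supNorm hd0 hm fun K hK k hk => ?_
    obtain ⟨-, hb⟩ := exists_isLittleOExp_supNorm_sub (ω := ω) hc
      (κ := fun _ => 2 * k) antitone_const (fun _ => by positivity)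
      (fun x K hK => ⟨0, (h x K hK 1 one_pos (2 * k) (by positivity)).mono fun ε =>
        supNorm_le_compactNorm zero_le_one (hd ε x)⟩) hK
    exact hb.weaken (by linarith)
  -- The exponent depends on the shift and the compact set, but each positive exponent exceeds some
  -- `1/(m+1)`, so countably many gauges suffice.
  · refine isNegligible_roumieu_of_supNorm hd0 hm fun K hK => ?_
    obtain ⟨m, hb⟩ := exists_isLittleOExp_supNorm_sub (ω := ω) hc
      (κ := fun m => 1 / ((m : ℝ) + 1)) (fun i j hij => Nat.one_div_le_one_div hij)
      (fun _ => by positivity)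
      (fun x K hK => by
        obtain ⟨k, hk, l, hl, hkl⟩ := h x K hK
        obtain ⟨m, hm⟩ := exists_nat_one_div_lt hk
        exact ⟨m, (hkl.weaken (neg_le_neg hm.le)).mono fun ε =>
          supNorm_le_compactNorm hl.le (hd ε x)⟩) hK
    exact ⟨_, by positivity, hb⟩

end Nullity

end Ultra

/-! ### Passage from representatives to classes -/

theorem mainTheorem7 (n : ℕ) (ω : WeightFunction) (T : Ultra.UltraType)
    (f : Ultra.GenFun ω T n)
    (hf : ∀ x : Rn n, Ultra.translate x f - f = 0) :
    f = Ultra.ofConst n (Ultra.pointValue 0 f) := by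
  obtain ⟨u, rfl⟩ := Ultra.GenFun.mk_surjective f
  rw [Ultra.pointValue_mk, Ultra.ofConst_mk, ← sub_eq_zero, ← map_sub, Ultra.GenFun.mk_eq_zero_iff]
  refine Ultra.isNegligible_sub_apply_zero (g := fun ε => (u.1 ε : Rn n → ℂ))
    (fun ε => (u.1 ε).2.continuous)
    -- Moderateness of `g ε - g ε 0` is membership of this difference in the algebra of moderate
    -- nets.
    (u - Ultra.moderateOfConst n (Ultra.moderatePointValue 0 u)).2 fun x => ?_
  have h := hf x
  rwa [Ultra.translate_mk, ← map_sub, Ultra.GenFun.mk_eq_zero_iff] at h
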